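/- Let $N\ge 2$. For a real lower triangular $(N-1)\times(N-1)$ matrix $H=(h_{k,j})$ consider the fixed-step method $y_{k+1}=y_k-\sum_{j=0}^{k}h_{k+1,j+1}(y_j-Ty_j)$, $k=0,\dots,N-2$. Let $\mathcal H_\star(N-1)$ be the set of such $H$ for which $\|y_{N-1}-Ty_{N-1}\|^2\le 4\|y_0-y_\star\|^2/N^2$ holds for every nonexpansive $T:\mathcal X\to\mathcal X$ on a real Hilbert space $\mathcal X$, every fixed point $y_\star$ of $T$ and every $y_0\in\mathcal X$. For $m\ge1$ and $1\le j\le N-1$ put $Q(m,j)=\sum\prod_{r=1}^m h_{i(r),j(r)}$, the sum being over all $j=j(1)\le i(1)<j(2)\le i(2)<\dots<j(m)\le i(m)\le N-1$. The H-certificates of $H$ are $\lambda^\star_{N,j}(H)=N\sum_{m=1}^{N-1}(-1)^{m-1}Q(m,j)$ for $1\le j\le N-1$, and $\lambda^\star_{k,j}(H)=N\sum_{\ell=1}^{N-1}\sum_{m=1}^{N-1}(-1)^{\ell+m-1}\binom{\ell+m}{m}Q(\ell,j)Q(m,k)$ for $1\le j<k\le N-1$. An *optimal vertex algorithm* (vertex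 of $\mathcal H_\star(N-1)$) is an $H\in\mathcal H_\star(N-1)$ for which the number of pairs $j<k$ with $\lambda^\star_{k,j}(H)=0$ is the largest possible within $\mathcal H_\star(N-1)$. The *diagram* $\mathcal G(H)$ of $H\in\mathcal H_\star(N-1)$ is the graph on $\{1,\dots,N\}$ in which $j<k$ are joined iff $\lambda^\star_{k,j}(H)\ne0$; if $H$ is a vertex, every node $j<N$ has exactly one larger neighbour, and $\mathcal G(H)$ is called its arc diagram. The *gluing* $\mathcal G_1\bowtie\mathcal G_2$ of diagrams on $N_1$ and $N_2$ nodes is the diagram on $N_1+N_2$ nodes obtained by placing $\mathcal G_2$ to the right of $\mathcal G_1$ (its node $i$ becoming $N_1+i$) and joining $N_1$ to $N_1+N_2$. *Basic* arc diagrams are the one-node diagram and, recursively, all gluings of basic arc diagrams. The *H-dual* of $H$ is $H^{\mathsf A}=(h_{N-j,N-k})_{k,j}$, and $H$ is *self-dual* if $H^{\mathsf A}=H$. An arc diagram determines its vertex uniquely. If $\mathcal G=\mathcal G(H)$ for a vertex $H$ such that $H^{\mathsf A}$ is again optimal (which is the case when $\mathcal G$ is basic), then $\mathcal G^{\mathsf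 A}:=\mathcal G(H^{\mathsf A})$ is the *dual* of $\mathcal G$. **Theorem.** Let $H\in\mathcal H_\star(N-1)$ be an optimal vertex algorithm with arc diagram $\mathcal G=\mathcal G(H)$. Then $H$ is self-dual if and only if $N$ is even and there is a basic arc diagram $\mathcal G_0$ on $\{1,\dots,N/2\}$ such that $$\mathcal G=\mathcal G_0\bowtie\mathcal G_0^{\mathsf A};$$ equivalently, $N$ is even, $\mathcal G$ is decomposable at $N/2$ (the larger neighbour of $N/2$ is $N$, and the larger neighbour of each $j<N/2$ is at most $N/2$), and the subdiagrams of $\mathcal G$ on $\{1,\dots,N/2\}$ and $\{N/2+1,\dots,N\}$ (the latter relabelled by $\{1,\dots,N/2\}$) are dual to each other, the second being the dual of the first. Consequently, there is no self-dual optimal vertex algorithm when $N$ is odd, and for even $N$ the number of self-dual optimal vertex algorithms is the Catalan number $$C_{N/2-1}=\frac{1}{N/2}\binom{N-2}{N/2-1}.$$ -/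

import Mathlib

noncomputable section

/-! Throughout, `n = N - 1`: an H-matrix of size `(N-1) × (N-1)` is a real matrix indexed by `Fin n`,
and the nodes of its diagram are `Fin (n + 1)`.  Indices start at `0` here, so that the row, column or
node `i` of the usual one-based numbering is `i - 1`. -/

/-- `y` is the sequence of iterates `y_0, …, y_{N-1}` of the fixed-step method with step sizes `H`:
`y_{k+1} = y_k - ∑_{j ≤ k} h_{k+1,j+1} (y_j - T y_j)`. -/
def IsIterates {n : ℕ} (H : Matrix (Fin n) (Fin n) ℝ) {X : Type} [NormedAddCommGroup X]
    [InnerProductSpace ℝ X] (T : X → X) (y : Fin (n + 1) → X) : Prop :=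
  ∀ k : Fin n, y k.succ =
    y k.castSucc - ∑ j ∈ Finset.univ.filter (fun j : Fin n => j ≤ k),
      H k j • (y j.castSucc - T (y j.castSucc))

/-- The set of minimax optimal lower triangular H-matrices of size `N - 1 = n`: on every real Hilbert
space, for every nonexpansive operator `T` with a fixed point `yStar` and every starting point, the
method satisfies `‖y_{N-1} - T y_{N-1}‖² ≤ 4 ‖y_0 - yStar‖² / N²`. -/
def HStar (n : ℕ) : Set (Matrix (Fin n) (Fin n) ℝ) :=
  {H | (∀ i j : Fin n, i < j → H i j = 0) ∧
    ∀ (X : Type) [NormedAddCommGroup X] [InnerProductSpace ℝ X] [CompleteSpace X]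
      (T : X → X) (yStar : X) (y : Fin (n + 1) → X),
      (∀ u v : X, ‖T u - T v‖ ≤ ‖u - v‖) → T yStar = yStar → IsIterates H T y →
        ‖y (Fin.last n) - T (y (Fin.last n))‖ ^ 2
          ≤ 4 * ‖y 0 - yStar‖ ^ 2 / ((n : ℝ) + 1) ^ 2}

/-- The Q-functions: `qFun H m j` is the sum of the products `∏_{r=1}^m h_{i(r),j(r)}` over all chains
`j = j(1) ≤ i(1) < j(2) ≤ i(2) < ⋯ < j(m) ≤ i(m)`, organised by the choice of `i(1)` and `j(2)`.
Only `m ≥ 1` is meaningful. -/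
def qFun {n : ℕ} (H : Matrix (Fin n) (Fin n) ℝ) : ℕ → Fin n → ℝ
  | 0, _ => 0
  | 1, j => ∑ i ∈ Finset.univ.filter (fun i : Fin n => j ≤ i), H i j
  | m + 2, j => ∑ i ∈ Finset.univ.filter (fun i : Fin n => j ≤ i),
      H i j * ∑ j' ∈ Finset.univ.filter (fun j' : Fin n => i < j'), qFun H (m + 1) j'

/-- The H-certificate `λ*_{k,j}(H)`, used for nodes `j < k`; the last node `k = N` has its own formula. -/
def hCert {n : ℕ} (H : Matrix (Fin n) (Fin n) ℝ) (k : Fin (n + 1)) (j : Fin n) : ℝ :=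
  if hk : k.val < n then
    ((n : ℝ) + 1) * ∑ l ∈ Finset.Icc 1 n, ∑ m ∈ Finset.Icc 1 n,
      (-1 : ℝ) ^ (l + m - 1) * ((l + m).choose m : ℝ) * qFun H l j * qFun H m ⟨k.val, hk⟩
  else
    ((n : ℝ) + 1) * ∑ m ∈ Finset.Icc 1 n, (-1 : ℝ) ^ (m - 1) * qFun H m j

/-- The number of pairs `j < k` of nodes with `λ*_{k,j}(H) = 0`. -/
def numZeroCerts {n : ℕ} (H : Matrix (Fin n) (Fin n) ℝ) : ℕ :=
  {p : Fin (n + 1) × Fin n | p.2.castSucc < p.1 ∧ hCert H p.1 p.2 = 0}.ncard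

/-- An optimal vertex algorithm: an optimal H-matrix lying on a maximal number of the zero sets
of the H-certificates. -/
def IsVertex {n : ℕ} (H : Matrix (Fin n) (Fin n) ℝ) : Prop :=
  H ∈ HStar n ∧ ∀ H' ∈ HStar n, numZeroCerts H' ≤ numZeroCerts H

/-- The H-dual: the anti-diagonal transpose, `(H^A)_{k,j} = h_{N-j,N-k}`. -/
def hDual {n : ℕ} (H : Matrix (Fin n) (Fin n) ℝ) : Matrix (Fin n) (Fin n) ℝ :=
  Matrix.of fun k j => H j.rev k.rev

/-- The diagram of `H` (identified with its support graph): nodes `j < k` are joined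
iff `λ*_{k,j}(H) ≠ 0`. -/
def diagram {n : ℕ} (H : Matrix (Fin n) (Fin n) ℝ) : SimpleGraph (Fin (n + 1)) :=
  SimpleGraph.fromRel fun a b => ∃ j : Fin n, b = j.castSucc ∧ b < a ∧ hCert H a j ≠ 0

/-- The position of node `i` of the left block, when a block of `N₁ = m + 1` nodes is followed by a
block of `N₂ = p + 1` nodes. -/
def leftNode {m p n : ℕ} (h : (m + 1) + (p + 1) = n + 1) (i : Fin (m + 1)) : Fin (n + 1) :=
  Fin.cast h (Fin.castAdd (p + 1) i)

/-- The position of node `i` of the right block. -/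
def rightNode {m p n : ℕ} (h : (m + 1) + (p + 1) = n + 1) (i : Fin (p + 1)) : Fin (n + 1) :=
  Fin.cast h (Fin.natAdd (m + 1) i)

/-- The gluing `G₁ ⋈ G₂`: place `G₂` to the right of `G₁` and join the two rightmost nodes. -/
def glue {m p n : ℕ} (h : (m + 1) + (p + 1) = n + 1)
    (G₁ : SimpleGraph (Fin (m + 1))) (G₂ : SimpleGraph (Fin (p + 1))) :
    SimpleGraph (Fin (n + 1)) :=
  SimpleGraph.fromRel fun a b =>
    (∃ i j, G₁.Adj i j ∧ a = leftNode h i ∧ b = leftNode h j) ∨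
    (∃ i j, G₂.Adj i j ∧ a = rightNode h i ∧ b = rightNode h j) ∨
    (a = leftNode h (Fin.last m) ∧ b = rightNode h (Fin.last p))

/-- Basic arc diagrams: the one-node diagram, and all gluings of basic arc diagrams. -/
inductive IsBasic : {n : ℕ} → SimpleGraph (Fin (n + 1)) → Prop
  | single (G : SimpleGraph (Fin (0 + 1))) : IsBasic G
  | glue {m p n : ℕ} (h : (m + 1) + (p + 1) = n + 1)
      (G₁ : SimpleGraph (Fin (m + 1))) (G₂ : SimpleGraph (Fin (p + 1))) :
      IsBasic G₁ → IsBasic G₂ → IsBasic (glue h G₁ G₂)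

/-- `G' = G^A`: `G` is the diagram of an optimal vertex algorithm whose H-dual is optimal,
and `G'` is the diagram of that H-dual. -/
def IsDualDiagram {n : ℕ} (G G' : SimpleGraph (Fin (n + 1))) : Prop :=
  ∃ H : Matrix (Fin n) (Fin n) ℝ,
    IsVertex H ∧ hDual H ∈ HStar n ∧ diagram H = G ∧ diagram (hDual H) = G'

/-- `G` is decomposable at the node `v`, which is not the last one: with `k(j)` denoting the larger
neighbour of `j`, `k(v)` is the last node and `k(j) ≤ v` for all `j < v`. -/
def DecomposableAt {n : ℕ} (G : SimpleGraph (Fin (n + 1))) (v : Fin (n + 1)) : Prop :=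
  v < Fin.last n ∧ (∀ k, v < k → (G.Adj v k ↔ k = Fin.last n)) ∧
    ∀ j k, j < v → j < k → G.Adj j k → k ≤ v

end

/-!
Write `N = n + 1`.  The proof encodes a lower triangular matrix `H` by an upper triangular matrix
`V = factor H` of size `N` whose rows carry the certificates: `λ*_{k,j}(H) = -N ⟨V_j, V_k⟩`
(`hCert_eq`).  The matrix `V` is characterized by `V U = B V` and by its row sums `0, …, 0, 1`,
where `U` is the strictly upper triangular matrix of ones and `B` holds the accumulated step
sizes.

*Optimality in terms of the factor* (`mem_HStar_iff`).  `H` is minimax optimal iff `V` has equal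
column sums `1 / N` and rows at pairwise obtuse angles.  If so, a nonnegative combination of the
nonexpansiveness inequalities of pairs of iterates, with the certificates as weights, gives the
rate.  Conversely, the rate for a cyclic shift with a sign change forces the column sums.  If some
`⟨V_j, V_k⟩` were positive, then a perturbation of the Gram matrix of a worst-case run, positive
semidefinite by Finsler's lemma, would describe a run violating the rate; Kirszbraun's theorem
extends the operator of this run from finitely many points to the whole space.

*Vertices* (`isVertex_iff`).  By the normalization of `V`, every node but the last has a larger
neighbour in the diagram, and there are diagrams with just one for each such node.  So vertices
are the optimal matrices whose diagram is an arc diagram, and then the diagram determines the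
matrix: going downwards, each row of `V` is determined up to a factor by orthogonality, and the
column sums fix the factors (`eq_of_factorGraph_eq`).

*Duality and gluing*.  With `V'` the factor of the H-dual, `V * hDual V' = N⁻¹ • difference`
(`isDualFactor_factor_hDual`).  A diagram is a gluing iff the factor is block triangular with an
explicit off-diagonal block (`factorGraph_glueFactor`, `exists_eq_glueFactor`), and the dual of a
gluing is the gluing of the duals in reverse order (`isDualFactor_glueFactor`).

*Noncrossing diagrams* (`isNoncrossing_of_isDualFactor`).  For a tree diagram the inverse of
`V Vᵀ` is the Green function of an electrical network, and optimality of the dual says that its rows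
do not increase beyond the diagonal.  A crossing of two arcs would propagate to later and later
nodes; so there is none, the diagram is basic, and it is a gluing at a unique place.

For a self-dual vertex, comparing the gluing `V = V₁ ⋈ V₂` with its dual `V₂' ⋈ V₁'` shows that
the blocks have equal sizes and `V₂ = V₁'`; the converse is the same computation.  So self-dual
vertices correspond to basic diagrams on `N / 2` nodes, and basic diagrams satisfy the Catalan
recursion (`card_isBasic`).
-/

noncomputable section

namespace OptimalVertex

open Finset Matrix

/-! ### The factor of an H-matrix -/

/-- The signed binomial coefficient of `z ^ k` in `(z - 1) ^ m`. -/
def binomCoeff (m k : ℕ) : ℝ := (-1) ^ (m + k) * (m.choose k : ℝ)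

lemma binomCoeff_add (m k : ℕ) :
    binomCoeff m (k + 1) + binomCoeff (m + 1) (k + 1) = binomCoeff m k := by
  simp only [binomCoeff, Nat.choose_succ_succ m k, Nat.cast_add]
  ring

lemma binomCoeff_of_lt {m k : ℕ} (h : m < k) : binomCoeff m k = 0 := by
  simp [binomCoeff, Nat.choose_eq_zero_of_lt h]

lemma sum_rev {n : ℕ} (f : Fin n → ℝ) : ∑ k : Fin n, f k.rev = ∑ k, f k :=
  Equiv.sum_comp Fin.revPerm f

lemma sum_lt_binomCoeff {n m : ℕ} (hm : m + 1 ≤ n) (c : ℕ) (hc : c ≤ n) :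
    ∑ i ∈ range c, binomCoeff (m + 1) (n - i) = binomCoeff m (n - c) := by
  induction c with
  | zero => simp [binomCoeff_of_lt (show m < n by omega)]
  | succ c ih =>
    rw [sum_range_succ, ih (by omega)]
    obtain ⟨d, hd⟩ : ∃ d, n - c = d + 1 := ⟨n - c - 1, by omega⟩
    rw [hd, binomCoeff_add, show n - (c + 1) = d by omega]

lemma sum_fin_lt {M : Type*} [AddCommMonoid M] {n : ℕ} (c : Fin (n + 1)) (g : ℕ → M) :
    ∑ i ∈ univ.filter (fun i : Fin (n + 1) => i < c), g i = ∑ i ∈ range c, g i := by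
  rw [← Finset.sum_image (g := fun i : Fin (n + 1) => (i : ℕ)) (f := g)]
  · congr 1
    ext x
    simp only [mem_image, mem_filter, mem_univ, true_and, mem_range]
    constructor
    · rintro ⟨i, hi, rfl⟩; exact hi
    · intro hx; exact ⟨⟨x, by omega⟩, hx, rfl⟩
  · intro a _ b _ h; exact Fin.ext h

lemma sum_binomCoeff {n m : ℕ} (hm : m ≤ n) :
    ∑ k : Fin (n + 1), binomCoeff m k = if m = 0 then 1 else 0 := by
  rw [Fin.sum_univ_eq_sum_range (fun k => binomCoeff m k), ← Finset.sum_range_reflect]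
  cases m with
  | zero =>
    rw [sum_range_succ]
    simp only [Nat.add_sub_cancel, Nat.sub_self]
    rw [sum_eq_zero]
    · simp [binomCoeff]
    · intro x hx
      exact binomCoeff_of_lt (by simp at hx; omega)
  | succ m =>
    rw [sum_range_succ]
    have := sum_lt_binomCoeff hm n le_rfl
    simp only [Nat.add_sub_cancel, Nat.sub_self] at this ⊢
    rw [this]
    simp [binomCoeff, pow_succ]

lemma sum_binomCoeff_mul {n l m : ℕ} (hm : m ≤ n) :
    ∑ k : Fin (n + 1), binomCoeff l k * binomCoeff m k
      = (-1) ^ (l + m) * ((l + m).choose m : ℝ) := by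
  have h1 : ∀ k, binomCoeff l k * binomCoeff m k
      = (-1) ^ (l + m) * ((l.choose k * m.choose k : ℕ) : ℝ) := by
    intro k
    have : ((-1 : ℝ)) ^ k * (-1) ^ k = 1 := by rw [← mul_pow]; simp
    simp only [binomCoeff, pow_add, Nat.cast_mul]
    linear_combination ((-1) ^ l * (-1) ^ m * (l.choose k : ℝ) * (m.choose k : ℝ)) * this
  simp only [h1, ← mul_sum]
  congr 1
  rw [Fin.sum_univ_eq_sum_range (fun k => ((l.choose k * m.choose k : ℕ) : ℝ)),
    Nat.add_choose_eq, Finset.Nat.sum_antidiagonal_eq_sum_range_succ_mk, ← Nat.cast_sum]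
  congr 1
  rw [show n + 1 = (m + 1) + (n - m) by omega, sum_range_add]
  rw [sum_eq_zero (s := range (n - m)), add_zero]
  · refine sum_congr rfl fun k hk => ?_
    rw [Nat.choose_symm (by simp at hk; omega)]
  · intro x _
    rw [Nat.choose_eq_zero_of_lt (show m < m + 1 + x by omega), mul_zero]

variable {n : ℕ}

/-- The cumulative step sizes: `y_k = y_0 - ∑_j stepCum H j k • (y_j - T y_j)`. -/
def stepCum (H : Matrix (Fin n) (Fin n) ℝ) : Matrix (Fin (n + 1)) (Fin (n + 1)) ℝ :=
  Matrix.of fun j k => Fin.lastCases (motive := fun _ => ℝ) 0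
    (fun j => ∑ l ∈ univ.filter (fun l : Fin n => l.castSucc < k), H l j) j

@[simp] lemma stepCum_last (H : Matrix (Fin n) (Fin n) ℝ) (k : Fin (n + 1)) :
    stepCum H (Fin.last n) k = 0 := by simp [stepCum]

@[simp] lemma stepCum_castSucc (H : Matrix (Fin n) (Fin n) ℝ) (j : Fin n) (k : Fin (n + 1)) :
    stepCum H j.castSucc k = ∑ l ∈ univ.filter (fun l : Fin n => l.castSucc < k), H l j := by
  simp [stepCum]

lemma stepCum_succ_sub (H : Matrix (Fin n) (Fin n) ℝ) (j k : Fin n) :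
    stepCum H j.castSucc k.succ = stepCum H j.castSucc k.castSucc + H k j := by
  rw [stepCum_castSucc, stepCum_castSucc]
  have : univ.filter (fun l : Fin n => l.castSucc < k.succ)
      = insert k (univ.filter (fun l : Fin n => l.castSucc < k.castSucc)) := by
    ext l
    simp only [mem_filter, mem_univ, true_and, mem_insert, Fin.lt_def, Fin.ext_iff,
      Fin.val_castSucc, Fin.val_succ]
    omega
  rw [this, sum_insert (by simp), add_comm]

lemma stepCum_zero (H : Matrix (Fin n) (Fin n) ℝ) (j : Fin (n + 1)) : stepCum H j 0 = 0 := by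
  cases j using Fin.lastCases <;> simp

/-- A lower triangular H-matrix is one all of whose entries above the diagonal vanish. -/
def IsLower (H : Matrix (Fin n) (Fin n) ℝ) : Prop := ∀ i j : Fin n, i < j → H i j = 0

lemma stepCum_of_le {H : Matrix (Fin n) (Fin n) ℝ} (hH : IsLower H) {j k : Fin (n + 1)}
    (h : k ≤ j) : stepCum H j k = 0 := by
  cases j using Fin.lastCases with
  | last => simp
  | cast j =>
    rw [stepCum_castSucc]
    refine sum_eq_zero fun l hl => hH l j ?_
    simp only [mem_filter, mem_univ, true_and] at hl
    exact Fin.castSucc_lt_castSucc_iff.mp (hl.trans_le h)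

/-- The vectors `stepCum H ^ m e`, with `e` the indicator of the last node; off the last node their
entries are the values of the Q-functions. -/
def pathSum (H : Matrix (Fin n) (Fin n) ℝ) : ℕ → Fin (n + 1) → ℝ
  | 0 => Pi.single (Fin.last n) 1
  | m + 1 => stepCum H *ᵥ pathSum H m

lemma pathSum_eq_zero {H : Matrix (Fin n) (Fin n) ℝ} (hH : IsLower H) (m : ℕ) (j : Fin (n + 1))
    (h : n < j + m) : pathSum H m j = 0 := by
  induction m generalizing j with
  | zero => omega
  | succ m ih =>
    simp only [pathSum, Matrix.mulVec, dotProduct]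
    refine sum_eq_zero fun k _ => ?_
    by_cases hk : k ≤ j
    · rw [stepCum_of_le hH hk, zero_mul]
    · rw [ih k (by rw [not_le, Fin.lt_def] at hk; omega), mul_zero]

lemma stepCum_castSucc_eq {H : Matrix (Fin n) (Fin n) ℝ} (hH : IsLower H) (j : Fin n)
    (k : Fin (n + 1)) : stepCum H j.castSucc k
      = ∑ l ∈ univ.filter (fun l : Fin n => j ≤ l), if l.castSucc < k then H l j else 0 := by
  rw [stepCum_castSucc, ← sum_filter, filter_filter, sum_filter, sum_filter]
  refine sum_congr rfl fun l _ => ?_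
  by_cases h : j ≤ l
  · simp [h]
  · simp [hH l j (not_le.mp h)]

lemma qFun_eq_pathSum {H : Matrix (Fin n) (Fin n) ℝ} (hH : IsLower H) (m : ℕ) (j : Fin n) :
    qFun H (m + 1) j = pathSum H (m + 1) j.castSucc := by
  induction m generalizing j with
  | zero =>
    simp only [qFun, pathSum, Matrix.mulVec_single_one, Matrix.col_apply]
    rw [stepCum_castSucc_eq hH]
    exact sum_congr rfl fun l _ => by simp [Fin.castSucc_lt_last]
  | succ m ih =>
    rw [qFun, pathSum, Matrix.mulVec, dotProduct, Fin.sum_univ_castSucc,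
      pathSum_eq_zero hH (m + 1) (Fin.last n) (by simp), mul_zero, add_zero]
    simp only [stepCum_castSucc_eq hH, sum_mul]
    rw [sum_comm]
    refine sum_congr rfl fun i _ => ?_
    rw [mul_sum, sum_filter]
    refine sum_congr rfl fun j' _ => ?_
    simp only [Fin.castSucc_lt_castSucc_iff, ih j']
    split_ifs <;> simp

/-- The factor of an H-matrix: row `j` lists, from the highest degree down, the coefficients of the
polynomial `∑_m pathSum H m j (z - 1) ^ m`.  Under the isometry sending `z ^ k` to the `k`-th Laguerre
polynomial it is the Laguerre expansion of `t ↦ ∑_m pathSum H m j (-t) ^ m / m!`. -/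
def factor (H : Matrix (Fin n) (Fin n) ℝ) : Matrix (Fin (n + 1)) (Fin (n + 1)) ℝ :=
  Matrix.of fun j k => ∑ m ∈ range (n + 1), pathSum H m j * binomCoeff m k.rev

/-- The strictly upper triangular all-ones matrix. -/
def strictUpperOnes (n : ℕ) : Matrix (Fin n) (Fin n) ℝ :=
  Matrix.of fun i j => if i < j then 1 else 0

lemma mul_strictUpperOnes_apply {ι : Type*} (X : Matrix ι (Fin n) ℝ) (i : ι) (c : Fin n) :
    (X * strictUpperOnes n) i c = ∑ b ∈ univ.filter (fun b => b < c), X i b := by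
  simp [Matrix.mul_apply, strictUpperOnes, sum_filter]

lemma factor_mul_strictUpperOnes {H : Matrix (Fin n) (Fin n) ℝ} (hH : IsLower H) :
    factor H * strictUpperOnes (n + 1) = stepCum H * factor H := by
  ext j c
  rw [mul_strictUpperOnes_apply]
  simp only [factor, Matrix.of_apply, Matrix.mul_apply, mul_sum]
  rw [sum_comm, sum_comm (s := univ)]
  simp only [← mul_assoc, ← mul_sum, ← sum_mul]
  have hrev : ∀ m, ∑ b ∈ univ.filter (fun b : Fin (n + 1) => b < c), binomCoeff m b.rev
      = ∑ i ∈ range c, binomCoeff m (n - i) := by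
    intro m
    rw [← sum_fin_lt c (fun i => binomCoeff m (n - i))]
    exact sum_congr rfl fun b _ => by rw [Fin.val_rev]; congr 1; omega
  simp only [hrev]
  rw [sum_range_succ', sum_range_succ]
  have h0 : ∑ i ∈ range c, binomCoeff 0 (n - i) = 0 :=
    sum_eq_zero fun i hi => binomCoeff_of_lt (by simp at hi; omega)
  have hlast : ∑ i, stepCum H j i * pathSum H n i = 0 := by
    have := pathSum_eq_zero hH (n + 1) j (by omega)
    simpa [pathSum, Matrix.mulVec, dotProduct] using this
  rw [h0, hlast, mul_zero, zero_mul]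
  congr 1
  refine sum_congr rfl fun m hm => ?_
  rw [sum_lt_binomCoeff (by simp at hm; omega) _ (by omega)]
  simp only [pathSum, Matrix.mulVec, dotProduct]
  congr 2
  rw [Fin.val_rev]; omega

lemma factor_row_sum {H : Matrix (Fin n) (Fin n) ℝ} (j : Fin (n + 1)) :
    ∑ k, factor H j k = if j = Fin.last n then 1 else 0 := by
  simp only [factor, Matrix.of_apply]
  rw [sum_comm]
  simp only [← mul_sum]
  rw [sum_range_succ', sum_eq_zero]
  · rw [sum_rev (fun k => binomCoeff 0 k), sum_binomCoeff (Nat.zero_le n)]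
    simp [pathSum, Pi.single_apply]
  · intro m hm
    rw [sum_rev (fun k => binomCoeff (m + 1) k), sum_binomCoeff (by simp at hm; omega)]
    simp

lemma factor_upper {H : Matrix (Fin n) (Fin n) ℝ} (hH : IsLower H) (j k : Fin (n + 1))
    (h : k < j) : factor H j k = 0 := by
  simp only [factor, Matrix.of_apply]
  refine sum_eq_zero fun m _ => ?_
  by_cases hm : n < j + m
  · rw [pathSum_eq_zero hH m j hm, zero_mul]
  · rw [binomCoeff_of_lt, mul_zero]
    rw [Fin.val_rev]; rw [Fin.lt_def] at h; omega

lemma factor_dotProduct {H : Matrix (Fin n) (Fin n) ℝ} (j k : Fin (n + 1)) :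
    factor H j ⬝ᵥ factor H k = ∑ l ∈ range (n + 1), ∑ m ∈ range (n + 1),
      (-1) ^ (l + m) * ((l + m).choose m : ℝ) * pathSum H l j * pathSum H m k := by
  have : ∀ i, factor H j i * factor H k i = ∑ l ∈ range (n + 1), ∑ m ∈ range (n + 1),
      pathSum H l j * pathSum H m k * (binomCoeff l i.rev * binomCoeff m i.rev) := by
    intro i
    simp only [factor, Matrix.of_apply, sum_mul_sum]
    exact sum_congr rfl fun l _ => sum_congr rfl fun m _ => by ring
  simp only [dotProduct, this]
  rw [sum_comm]
  refine sum_congr rfl fun l hl => ?_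
  rw [sum_comm]
  refine sum_congr rfl fun m hm => ?_
  rw [← mul_sum, sum_rev (fun i => binomCoeff l i * binomCoeff m i),
    sum_binomCoeff_mul (by simp at hm; omega)]
  ring

/-- The H-certificates are, up to the factor `-N`, the inner products of the rows of the factor. -/
lemma hCert_eq {H : Matrix (Fin n) (Fin n) ℝ} (hH : IsLower H) (k : Fin (n + 1)) (j : Fin n) :
    hCert H k j = -(((n : ℝ) + 1) * (factor H j.castSucc ⬝ᵥ factor H k)) := by
  have hsum : ∀ g : ℕ → ℝ, g 0 = 0 → ∑ m ∈ range (n + 1), g m = ∑ m ∈ Icc 1 n, g m := by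
    intro g hg
    rw [Finset.range_eq_Ico, Finset.sum_eq_sum_Ico_succ_bot (by omega), hg, zero_add]
    rfl
  have hq : ∀ m ∈ Icc 1 n, ∀ j : Fin n, qFun H m j = pathSum H m j.castSucc := by
    intro m hm j
    obtain ⟨m', rfl⟩ : ∃ m', m = m' + 1 := ⟨m - 1, by simp at hm; omega⟩
    exact qFun_eq_pathSum hH m' j
  have h0 : ∀ j : Fin n, pathSum H 0 j.castSucc = 0 := by
    intro j; simp [pathSum, (Fin.castSucc_lt_last j).ne]
  rw [factor_dotProduct, ← mul_neg]
  unfold hCert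
  split_ifs with hk
  · congr 1
    obtain ⟨k, rfl⟩ : ∃ k' : Fin n, k = k'.castSucc := ⟨⟨k, hk⟩, rfl⟩
    rw [hsum _ (by simp [h0]), ← sum_neg_distrib]
    refine sum_congr rfl fun l hl => ?_
    rw [hsum _ (by simp [h0]), ← sum_neg_distrib]
    refine sum_congr rfl fun m hm => ?_
    rw [hq l hl, hq m hm]
    have : l + m = (l + m - 1) + 1 := by simp at hl; omega
    have h2 : ((-1 : ℝ)) ^ (l + m) = -(-1) ^ (l + m - 1) := by
      conv_lhs => rw [this, pow_succ]
      ring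
    rw [h2]
    simp only [Fin.val_castSucc]
    ring_nf
  · obtain rfl : k = Fin.last n := Fin.ext (by simp; omega)
    rw [hsum _ (by simp [h0]), ← sum_neg_distrib]
    refine congrArg _ (sum_congr rfl fun l hl => ?_)
    rw [hq l hl, sum_range_succ', sum_eq_zero]
    · have : l = (l - 1) + 1 := by simp at hl; omega
      have h2 : ((-1 : ℝ)) ^ l = -(-1) ^ (l - 1) := by
        conv_lhs => rw [this, pow_succ]
        ring
      simp [pathSum, h2]
    · intro m _
      rw [pathSum_eq_zero hH (m + 1) (Fin.last n) (by simp), mul_zero]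

/-! ### Kirszbraun's extension theorem and Finsler's lemma -/

section Kirszbraun

variable {E : Type*} [NormedAddCommGroup E] [InnerProductSpace ℝ E]

/-- The variance identity: twice the variance of a weighted family is its mean squared distance. -/
lemma sum_mul_norm_sub_sq {ι : Type*} [Fintype ι] (w : ι → ℝ) (x : ι → E) (hw : ∑ i, w i = 1) :
    ∑ i, ∑ j, w i * w j * ‖x i - x j‖ ^ 2
      = 2 * (∑ i, w i * ‖x i‖ ^ 2 - ‖∑ i, w i • x i‖ ^ 2) := by
  have h1 : ∀ i j, w i * w j * ‖x i - x j‖ ^ 2 = w j * (w i * ‖x i‖ ^ 2)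
      + w i * (w j * ‖x j‖ ^ 2) - 2 * (w i * (w j * inner ℝ (x i) (x j))) := by
    intro i j
    rw [@norm_sub_sq ℝ]
    simp only [RCLike.re_to_real]
    ring
  have h2 : ‖∑ i, w i • x i‖ ^ 2 = ∑ i, w i * ∑ j, w j * inner ℝ (x i) (x j) := by
    rw [← real_inner_self_eq_norm_sq, sum_inner]
    simp only [inner_sum, real_inner_smul_left, real_inner_smul_right, mul_sum]
    exact sum_congr rfl fun i _ => sum_congr rfl fun j _ => mul_left_comm _ _ _
  simp only [h1, sum_sub_distrib, sum_add_distrib, ← mul_sum, ← sum_mul, hw, h2]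
  ring

/-- The one-point extension step of Kirszbraun's theorem for finitely many points.  The new value is
the barycentre of the old values for the weights maximizing the concave dual function. -/
lemma exists_forall_norm_sub_le_of_finite {ι : Type*} [Fintype ι] [Nonempty ι] (x t : ι → E)
    (h : ∀ i j, ‖t i - t j‖ ≤ ‖x i - x j‖) (p : E) : ∃ q, ∀ i, ‖q - t i‖ ≤ ‖p - x i‖ := by
  classical
  set c : ι → ℝ := fun i => ‖t i‖ ^ 2 - ‖p - x i‖ ^ 2 with hc
  set D : (ι → ℝ) → ℝ := fun w => ∑ i, w i * c i - ‖∑ i, w i • t i‖ ^ 2 with hD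
  have hcont : Continuous D := by fun_prop
  obtain ⟨w, hw, hmax⟩ := (isCompact_stdSimplex ℝ ι).exists_isMaxOn
    ⟨_, single_mem_stdSimplex ℝ (Classical.arbitrary ι)⟩ hcont.continuousOn
  set q := ∑ i, w i • t i with hq
  have hDw : D w ≤ 0 := by
    have e1 := sum_mul_norm_sub_sq w t hw.2
    have e2 := sum_mul_norm_sub_sq w (fun i => p - x i) hw.2
    have e3 : ∑ i, ∑ j, w i * w j * ‖t i - t j‖ ^ 2
        ≤ ∑ i, ∑ j, w i * w j * ‖(p - x i) - (p - x j)‖ ^ 2 := by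
      refine sum_le_sum fun i _ => sum_le_sum fun j _ => ?_
      refine mul_le_mul_of_nonneg_left ?_ (mul_nonneg (hw.1 i) (hw.1 j))
      rw [sub_sub_sub_cancel_left, norm_sub_rev (x j)]
      exact pow_le_pow_left₀ (norm_nonneg _) (h i j) 2
    have e4 := sq_nonneg ‖∑ i, w i • (p - x i)‖
    have e5 : D w = ∑ i, w i * ‖t i‖ ^ 2 - ∑ i, w i * ‖p - x i‖ ^ 2 - ‖q‖ ^ 2 := by
      simp only [hD, hc, mul_sub, sum_sub_distrib]
      rfl
    simp only [← hq] at e1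
    linarith
  refine ⟨q, fun i => ?_⟩
  have key : ∀ s : ℝ, 0 ≤ s → s ≤ 1 →
      s * (c i - ∑ j, w j * c j - 2 * inner ℝ q (t i - q)) ≤ s ^ 2 * ‖t i - q‖ ^ 2 := by
    intro s hs0 hs1
    have hmem : (1 - s) • w + s • Pi.single i 1 ∈ stdSimplex ℝ ι :=
      convex_stdSimplex ℝ ι hw (single_mem_stdSimplex ℝ i) (by linarith) hs0 (by ring)
    have hle := hmax hmem
    have e1 : ∑ j, ((1 - s) • w + s • (Pi.single i 1 : ι → ℝ)) j * c j
        = (1 - s) * ∑ j, w j * c j + s * c i := by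
      simp [add_mul, sum_add_distrib, mul_assoc, ← mul_sum, Pi.single_apply]
    have e2 : ∑ j, ((1 - s) • w + s • (Pi.single i 1 : ι → ℝ)) j • t j = q + s • (t i - q) := by
      simp only [Pi.add_apply, Pi.smul_apply, smul_eq_mul, add_smul, sum_add_distrib, mul_smul,
        ← smul_sum, Pi.single_apply, ite_smul, one_smul, zero_smul, sum_ite_eq', mem_univ, if_true]
      rw [← hq]; module
    simp only [Set.mem_ofPred_eq, hD] at hle
    rw [e1, e2, ← hq, @norm_add_sq ℝ, inner_smul_right, norm_smul, Real.norm_eq_abs,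
      abs_of_nonneg hs0, mul_pow] at hle
    simp only [RCLike.re_to_real] at hle
    linarith
  have hlim : c i - ∑ j, w j * c j - 2 * inner ℝ q (t i - q) ≤ 0 := by
    by_contra! hpos
    set a := c i - ∑ j, w j * c j - 2 * inner ℝ q (t i - q)
    set b := ‖t i - q‖ ^ 2
    have hb : 0 ≤ b := sq_nonneg _
    have hs := key (a / (a + b + 1)) (by positivity) (by rw [div_le_one (by positivity)]; linarith)
    have h1 : 0 < a / (a + b + 1) := by positivity
    have h2 : a ≤ a / (a + b + 1) * b := by
      refine le_of_mul_le_mul_left ?_ h1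
      calc _ ≤ _ := hs
        _ = _ := by ring
    rw [div_mul_eq_mul_div, le_div_iff₀ (by positivity)] at h2
    nlinarith
  have hfin : ‖q - t i‖ ^ 2 ≤ ‖p - x i‖ ^ 2 := by
    have e : D w = ∑ j, w j * c j - ‖q‖ ^ 2 := rfl
    rw [@norm_sub_sq ℝ]
    rw [inner_sub_right, real_inner_self_eq_norm_sq] at hlim
    simp only [RCLike.re_to_real]
    simp only [hc] at hlim e
    linarith
  exact le_of_sq_le_sq hfin (norm_nonneg _)

/-- The one-point extension step of Kirszbraun's theorem. -/
lemma exists_forall_norm_sub_le [FiniteDimensional ℝ E] (S : Set (E × E))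
    (hS : ∀ a ∈ S, ∀ b ∈ S, ‖a.2 - b.2‖ ≤ ‖a.1 - b.1‖) (p : E) :
    ∃ q, ∀ a ∈ S, ‖q - a.2‖ ≤ ‖p - a.1‖ := by
  classical
  rcases S.eq_empty_or_nonempty with rfl | ⟨a₀, ha₀⟩
  · simp
  have := FiniteDimensional.proper_real E
  have key := (isCompact_closedBall a₀.2 ‖p - a₀.1‖).inter_iInter_nonempty
    (fun a : S => Metric.closedBall a.1.2 ‖p - a.1.1‖) (fun _ => Metric.isClosed_closedBall)
    (fun u => by
      have : Nonempty {a : S // a ∈ insert (⟨a₀, ha₀⟩ : S) u} :=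
        ⟨⟨_, Finset.mem_insert_self _ _⟩⟩
      obtain ⟨q, hq⟩ := exists_forall_norm_sub_le_of_finite
        (ι := {a : S // a ∈ insert (⟨a₀, ha₀⟩ : S) u})
        (fun a => a.1.1.1) (fun a => a.1.1.2) (fun i j => hS _ i.1.2 _ j.1.2) p
      refine ⟨q, ?_, ?_⟩
      · rw [mem_closedBall_iff_norm]
        exact hq ⟨_, Finset.mem_insert_self _ _⟩
      · simp only [Set.mem_iInter, mem_closedBall_iff_norm]
        exact fun i hi => hq ⟨i, Finset.mem_insert_of_mem hi⟩)
  obtain ⟨q, -, hq⟩ := key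
  simp only [Set.mem_iInter, mem_closedBall_iff_norm] at hq
  exact ⟨q, fun a ha => hq ⟨a, ha⟩⟩

/-- **Kirszbraun's theorem** in finite dimension: a nonexpansive relation extends to a nonexpansive
map of the whole space. -/
theorem exists_nonexpansive_extension [FiniteDimensional ℝ E] (S : Set (E × E))
    (hS : ∀ a ∈ S, ∀ b ∈ S, ‖a.2 - b.2‖ ≤ ‖a.1 - b.1‖) :
    ∃ T : E → E, (∀ u v, ‖T u - T v‖ ≤ ‖u - v‖) ∧ ∀ a ∈ S, T a.1 = a.2 := by
  obtain ⟨M, hSM, hM⟩ := zorn_subset_nonempty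
    {S : Set (E × E) | ∀ a ∈ S, ∀ b ∈ S, ‖a.2 - b.2‖ ≤ ‖a.1 - b.1‖}
    (fun C hC hchain hne => ⟨⋃₀ C, by
      rintro a ⟨A, hA, ha⟩ b ⟨B, hB, hb⟩
      rcases hchain.total hA hB with h | h
      · exact hC hB a (h ha) b hb
      · exact hC hA a ha b (h hb), fun s hs => Set.subset_sUnion_of_mem hs⟩) S hS
  have hex : ∀ p, ∃ q, (p, q) ∈ M := by
    intro p
    obtain ⟨q, hq⟩ := exists_forall_norm_sub_le M hM.prop p
    refine ⟨q, hM.le_of_ge (y := insert (p, q) M) ?_ (Set.subset_insert _ _)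
      (Set.mem_insert _ _)⟩
    rintro a (rfl | ha) b (rfl | hb)
    · simp
    · exact hq b hb
    · rw [norm_sub_rev, norm_sub_rev a.1]; exact hq a ha
    · exact hM.prop a ha b hb
  choose T hT using hex
  refine ⟨T, fun u v => hM.prop _ (hT u) _ (hT v), fun a ha => ?_⟩
  have := hM.prop _ (hT a.1) _ (hSM ha)
  simpa [sub_eq_zero] using this

end Kirszbraun

/-- **Finsler's lemma**: a quadratic form that is positive on the kernel of a positive semidefinite
one becomes positive semidefinite after adding a large multiple of the latter. -/
lemma exists_posSemidef_smul_add {ι : Type*} [Fintype ι] [DecidableEq ι] {P Q : Matrix ι ι ℝ}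
    (hP : P.PosSemidef) (hQ : Q.IsHermitian)
    (h : ∀ x : ι → ℝ, x ≠ 0 → x ⬝ᵥ P *ᵥ x = 0 → 0 < x ⬝ᵥ Q *ᵥ x) :
    ∃ K : ℝ, 0 < K ∧ (K • P + Q).PosSemidef := by
  have hP0 : ∀ x : ι → ℝ, 0 ≤ x ⬝ᵥ P *ᵥ x := fun x => by
    simpa using hP.dotProduct_mulVec_nonneg x
  have hcP : Continuous fun x : ι → ℝ => x ⬝ᵥ P *ᵥ x := by fun_prop
  have hcQ : Continuous fun x : ι → ℝ => x ⬝ᵥ Q *ᵥ x := by fun_prop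
  have hex : ∃ k : ℕ, ∀ x ∈ Metric.sphere (0 : ι → ℝ) 1,
      0 ≤ (k + 1 : ℝ) * (x ⬝ᵥ P *ᵥ x) + x ⬝ᵥ Q *ᵥ x := by
    by_contra! hcon
    have hcl : ∀ k : ℕ, IsClosed (Metric.sphere (0 : ι → ℝ) 1 ∩
        {x | (k + 1 : ℝ) * (x ⬝ᵥ P *ᵥ x) + x ⬝ᵥ Q *ᵥ x ≤ 0}) := fun k =>
      Metric.isClosed_sphere.inter (isClosed_le (by fun_prop) continuous_const)
    obtain ⟨x, hx⟩ := IsCompact.nonempty_iInter_of_sequence_nonempty_isCompact_isClosed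
      (fun k : ℕ => Metric.sphere (0 : ι → ℝ) 1 ∩
        {x | (k + 1 : ℝ) * (x ⬝ᵥ P *ᵥ x) + x ⬝ᵥ Q *ᵥ x ≤ 0})
      (fun k x hx => ⟨hx.1, by
        have h1 := hx.2
        have h2 := hP0 x
        simp only [Set.mem_ofPred_eq] at h1 ⊢
        push_cast at h1
        linarith⟩)
      (fun k => by
        obtain ⟨x, hx, hlt⟩ := hcon k
        exact ⟨x, hx, hlt.le⟩)
      ((isCompact_sphere _ _).inter_right (isClosed_le (by fun_prop) continuous_const)) hcl
    simp only [Set.mem_iInter, Set.mem_inter_iff, Set.mem_ofPred_eq] at hx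
    have hx0 : x ≠ 0 := by
      rintro rfl
      simpa using (hx 0).1
    have hPx : x ⬝ᵥ P *ᵥ x = 0 := by
      by_contra hne
      have hpos : 0 < x ⬝ᵥ P *ᵥ x := lt_of_le_of_ne (hP0 x) (Ne.symm hne)
      obtain ⟨k, hk⟩ := exists_nat_gt (-(x ⬝ᵥ Q *ᵥ x) / (x ⬝ᵥ P *ᵥ x))
      rw [div_lt_iff₀ hpos] at hk
      have := (hx k).2
      linarith
    have := (hx 0).2
    rw [hPx] at this
    linarith [h x hx0 hPx]
  obtain ⟨k, hk⟩ := hex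
  refine ⟨k + 1, by positivity, ?_⟩
  refine Matrix.PosSemidef.of_dotProduct_mulVec_nonneg ?_ fun x => ?_
  · refine IsHermitian.add ?_ hQ
    have := hP.isHermitian
    simp only [IsHermitian, conjTranspose_smul] at this ⊢
    rw [this]; simp
  · simp only [star_trivial, add_mulVec, smul_mulVec, dotProduct_add, dotProduct_smul, smul_eq_mul]
    by_cases hx : x = 0
    · simp [hx]
    have hn : 0 < ‖x‖ := norm_pos_iff.mpr hx
    have := hk (‖x‖⁻¹ • x) (by simp [norm_smul, hn.ne'])
    simp only [mulVec_smul, dotProduct_smul, smul_dotProduct, smul_eq_mul] at this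
    have h2 : 0 ≤ ‖x‖⁻¹ * ‖x‖⁻¹ * ((k + 1 : ℝ) * (x ⬝ᵥ P *ᵥ x) + x ⬝ᵥ Q *ᵥ x) := by linarith
    exact nonneg_of_mul_nonneg_right h2 (by positivity)

/-- A positive semidefinite matrix is the Gram matrix of vectors of a Euclidean space. -/
lemma exists_gram {ι : Type} [Fintype ι] [DecidableEq ι] {Θ : Matrix ι ι ℝ} (h : Θ.PosSemidef) :
    ∃ Y : ι → EuclideanSpace ℝ ι, ∀ a b, inner ℝ (Y a) (Y b) = Θ a b := by
  open scoped MatrixOrder ComplexOrder in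
  obtain ⟨C, hC⟩ := CStarAlgebra.nonneg_iff_eq_star_mul_self.mp
    (Matrix.nonneg_iff_posSemidef.mpr h)
  refine ⟨fun a => WithLp.toLp 2 fun i => C i a, fun a b => ?_⟩
  rw [hC]
  simp [PiLp.inner_apply, Matrix.mul_apply, Matrix.star_apply, mul_comm]

/-! ### Factors and the iterates of the method -/

/-- The normalization satisfied by the factors of minimax optimal H-matrices (the H-invariants):
upper triangular with nonzero diagonal, with row sums `0, …, 0, 1` and with all column sums equal. -/
structure IsNormalized (V : Matrix (Fin (n + 1)) (Fin (n + 1)) ℝ) : Prop where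
  upper : ∀ j k, k < j → V j k = 0
  diag : ∀ j, V j j ≠ 0
  row : ∀ j, ∑ k, V j k = if j = Fin.last n then 1 else 0
  col : ∀ k, ∑ j, V j k = 1 / ((n : ℝ) + 1)

/-- The factors of minimax optimal H-matrices: normalized, with rows at pairwise obtuse angles. -/
structure IsOptimalFactor (V : Matrix (Fin (n + 1)) (Fin (n + 1)) ℝ) : Prop
    extends IsNormalized V where
  obtuse : ∀ j k, j ≠ k → V j ⬝ᵥ V k ≤ 0

section Iterates

variable {X : Type} [NormedAddCommGroup X] [InnerProductSpace ℝ X]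

lemma isIterates_iff {H : Matrix (Fin n) (Fin n) ℝ} (hH : IsLower H) (T : X → X)
    (y : Fin (n + 1) → X) :
    IsIterates H T y ↔ ∀ k, y k = y 0 - ∑ j, stepCum H j k • (y j - T (y j)) := by
  have hsum : ∀ k : Fin n, ∑ j ∈ univ.filter (fun j : Fin n => j ≤ k),
      H k j • (y j.castSucc - T (y j.castSucc)) = ∑ j, H k j • (y j.castSucc - T (y j.castSucc)) := by
    intro k
    rw [sum_filter]
    refine sum_congr rfl fun j _ => ?_
    split_ifs with h
    · rfl
    · rw [hH k j (not_le.mp h), zero_smul]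
  have hstep : ∀ k : Fin n, ∑ j, stepCum H j k.succ • (y j - T (y j))
      = ∑ j, stepCum H j k.castSucc • (y j - T (y j))
        + ∑ j, H k j • (y j.castSucc - T (y j.castSucc)) := by
    intro k
    rw [Fin.sum_univ_castSucc, Fin.sum_univ_castSucc]
    simp only [stepCum_succ_sub, add_smul, sum_add_distrib, stepCum_last, zero_smul]
    abel
  constructor
  · intro h k
    induction k using Fin.induction with
    | zero => simp [stepCum_zero]
    | succ k ih =>
      rw [h k, hsum, hstep]
      nth_rw 1 [ih]
      abel
  · intro h k
    rw [hsum, h k.succ, hstep, h k.castSucc]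
    abel

lemma exists_isIterates (H : Matrix (Fin n) (Fin n) ℝ) (T : X → X) (y₀ : X) :
    ∃ y : Fin (n + 1) → X, y 0 = y₀ ∧ IsIterates H T y := by
  have key : ∀ m : ℕ, ∃ y : Fin (n + 1) → X, y 0 = y₀ ∧ ∀ k : Fin n, (k : ℕ) < m →
      y k.succ = y k.castSucc - ∑ j ∈ univ.filter (fun j : Fin n => j ≤ k),
        H k j • (y j.castSucc - T (y j.castSucc)) := by
    intro m
    induction m with
    | zero => exact ⟨fun _ => y₀, rfl, fun k hk => absurd hk (Nat.not_lt_zero _)⟩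
    | succ m ih =>
      obtain ⟨y, h0, hy⟩ := ih
      by_cases hm : m < n
      · set i : Fin n := ⟨m, hm⟩
        refine ⟨Function.update y i.succ (y i.castSucc - ∑ j ∈ univ.filter (fun j : Fin n => j ≤ i),
          H i j • (y j.castSucc - T (y j.castSucc))), ?_, fun k hk => ?_⟩
        · rw [Function.update_of_ne (Fin.succ_ne_zero i).symm, h0]
        · have hne : ∀ j : Fin n, j ≤ k → j.castSucc ≠ i.succ := by
            intro j hj h
            have := congrArg Fin.val h
            rw [Fin.le_def] at hj
            simp [i] at this
            omega
          rw [Function.update_of_ne (hne k le_rfl)]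
          have hs : ∑ j ∈ univ.filter (fun j : Fin n => j ≤ k), H k j •
              (Function.update y i.succ (y i.castSucc - ∑ j ∈ univ.filter (fun j : Fin n => j ≤ i),
                H i j • (y j.castSucc - T (y j.castSucc))) j.castSucc
              - T (Function.update y i.succ (y i.castSucc -
                ∑ j ∈ univ.filter (fun j : Fin n => j ≤ i),
                  H i j • (y j.castSucc - T (y j.castSucc))) j.castSucc))
              = ∑ j ∈ univ.filter (fun j : Fin n => j ≤ k),
                H k j • (y j.castSucc - T (y j.castSucc)) := by
            refine sum_congr rfl fun j hj => ?_
            rw [Function.update_of_ne (hne j (by simpa using hj))]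
          rw [hs]
          rcases Nat.lt_succ_iff_lt_or_eq.mp hk with h | h
          · rw [Function.update_of_ne, hy k h]
            intro h'
            have := congrArg Fin.val h'
            simp [i] at this
            omega
          · obtain rfl : k = i := Fin.ext h
            rw [Function.update_self]
      · exact ⟨y, h0, fun k hk => hy k (by omega)⟩
  obtain ⟨y, h0, hy⟩ := key n
  exact ⟨y, h0, fun k => hy k k.2⟩

end Iterates

/-! ### Necessity of the H-invariants -/

lemma sum_filter_lt_sub {M : Type*} [AddCommGroup M] (f : ℕ → M) (b : Fin (n + 1)) :
    ∑ c ∈ univ.filter (fun c : Fin (n + 1) => b < c), (f c.rev - f (c.rev + 1))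
      = f 0 - f b.rev := by
  rw [← Finset.sum_range_sub' f (b.rev : ℕ), ← sum_fin_lt b.rev (fun i => f i - f (i + 1)),
    sum_filter, sum_filter, ← Equiv.sum_comp Fin.revPerm]
  refine sum_congr rfl fun c _ => ?_
  simp [Fin.lt_rev_iff]

/-- For a linear operator, the last iterate is the polynomial in the operator whose coefficients are
the column sums of the factor. -/
lemma iterate_last_eq_of_linear {X : Type} [NormedAddCommGroup X] [InnerProductSpace ℝ X]
    {H : Matrix (Fin n) (Fin n) ℝ} (hH : IsLower H) (T : X →ₗ[ℝ] X) {y : Fin (n + 1) → X}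
    (hy : IsIterates H T y) :
    y (Fin.last n) = ∑ c : Fin (n + 1), (∑ j, factor H j c) • (T ^ (c.rev : ℕ)) (y 0) := by
  rw [isIterates_iff hH] at hy
  have h0 : ∀ j, y 0 = y j + ∑ i, stepCum H i j • (y i - T (y i)) := fun j => by
    have h := hy j
    rw [eq_sub_iff_add_eq] at h
    exact h.symm
  have hB : ∀ i c, ∑ j, stepCum H i j * factor H j c
      = ∑ b ∈ univ.filter (fun b => b < c), factor H i b := fun i c => by
    rw [← mul_strictUpperOnes_apply, factor_mul_strictUpperOnes hH, Matrix.mul_apply]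
  have e1 : ∀ c j, factor H j c • (T ^ (c.rev : ℕ)) (y 0) = factor H j c • (T ^ (c.rev : ℕ)) (y j)
      + ∑ i, (stepCum H i j * factor H j c) •
        ((T ^ (c.rev : ℕ)) (y i) - (T ^ ((c.rev : ℕ) + 1)) (y i)) := by
    intro c j
    conv_lhs => rw [h0 j]
    rw [map_add, smul_add, map_sum, smul_sum]
    congr 1
    refine sum_congr rfl fun i _ => ?_
    rw [map_smul, map_sub, smul_smul, mul_comm, pow_succ, Module.End.mul_apply]
  have e2 : ∀ c, (∑ j, factor H j c) • (T ^ (c.rev : ℕ)) (y 0)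
      = ∑ j, factor H j c • (T ^ (c.rev : ℕ)) (y j)
        + ∑ i, ∑ b, if b < c then factor H i b •
        ((T ^ (c.rev : ℕ)) (y i) - (T ^ ((c.rev : ℕ) + 1)) (y i)) else 0 := by
    intro c
    simp only [sum_smul, e1, sum_add_distrib]
    congr 1
    rw [sum_comm]
    refine sum_congr rfl fun i _ => ?_
    rw [← sum_smul, hB, sum_smul, sum_filter]
  have e3 : ∑ c, ∑ i, ∑ b, (if b < c then factor H i b •
        ((T ^ (c.rev : ℕ)) (y i) - (T ^ ((c.rev : ℕ) + 1)) (y i)) else 0)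
      = ∑ i, ∑ b, factor H i b • (y i - (T ^ (b.rev : ℕ)) (y i)) := by
    rw [sum_comm]
    refine sum_congr rfl fun i _ => ?_
    rw [sum_comm]
    refine sum_congr rfl fun b _ => ?_
    rw [← sum_filter, ← smul_sum, sum_filter_lt_sub (fun k => (T ^ k) (y i)) b]
    simp
  rw [sum_congr rfl fun c _ => e2 c, sum_add_distrib, e3]
  simp only [smul_sub, sum_sub_distrib, ← sum_smul, factor_row_sum]
  rw [sum_comm]
  simp

/-- The negacyclic shift, the isometry sending each basis vector to the next one and the last one to
the opposite of the first one. -/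
def negacyclicShift (n : ℕ) :
    EuclideanSpace ℝ (Fin (n + 1)) →ₗ[ℝ] EuclideanSpace ℝ (Fin (n + 1)) where
  toFun x := WithLp.toLp 2 fun i =>
    Fin.cases (motive := fun _ => ℝ) (-x (Fin.last n)) (fun j => x j.castSucc) i
  map_add' x y := by
    ext i
    cases i using Fin.cases <;> simp [add_comm]
  map_smul' r x := by
    ext i
    cases i using Fin.cases <;> simp

lemma norm_negacyclicShift (x : EuclideanSpace ℝ (Fin (n + 1))) : ‖negacyclicShift n x‖ = ‖x‖ := by
  rw [EuclideanSpace.norm_eq, EuclideanSpace.norm_eq, Fin.sum_univ_succ, Fin.sum_univ_castSucc]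
  simp [negacyclicShift, add_comm]

lemma negacyclicShift_pow_single (k : Fin (n + 1)) :
    (negacyclicShift n ^ (k : ℕ)) (EuclideanSpace.single 0 1) = EuclideanSpace.single k 1 := by
  induction k using Fin.induction with
  | zero => simp
  | succ k ih =>
    rw [Fin.val_succ, pow_succ', Module.End.mul_apply]
    rw [Fin.val_castSucc] at ih
    rw [ih]
    ext i
    cases i using Fin.cases with
    | zero =>
      simp [negacyclicShift, Fin.succ_ne_zero, (Fin.castSucc_lt_last k).ne']
    | succ i => simp [negacyclicShift]

/-- For the negacyclic shift, the rate bounds the sum of the squares of the column sums by `1 / N`.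
As the `N` column sums add up to `1`, they are equal. -/
lemma factor_col_sum {H : Matrix (Fin n) (Fin n) ℝ} (hH : H ∈ HStar n) (c : Fin (n + 1)) :
    ∑ j, factor H j c = 1 / ((n : ℝ) + 1) := by
  have hl : IsLower H := hH.1
  set T := negacyclicShift n
  set o : EuclideanSpace ℝ (Fin (n + 1)) := WithLp.toLp 2 fun _ => 1 with ho
  obtain ⟨y, hy0, hy⟩ := exists_isIterates H T o
  have hrate := hH.2 _ T 0 y (fun u v => by rw [← map_sub, norm_negacyclicShift]) (map_zero T) hy
  have hTo : o - T o = (2 : ℝ) • EuclideanSpace.single 0 1 := by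
    ext i
    cases i using Fin.cases with
    | zero => simp [o, T, negacyclicShift]; norm_num
    | succ i => simp [o, T, negacyclicShift]
  set a : Fin (n + 1) → ℝ := fun c => ∑ j, factor H j c with ha
  have hg : y (Fin.last n) - T (y (Fin.last n))
      = WithLp.toLp 2 fun i => 2 * a i.rev := by
    rw [iterate_last_eq_of_linear hl T hy, hy0, map_sum, ← sum_sub_distrib]
    have : ∀ c : Fin (n + 1), a c • (T ^ (c.rev : ℕ)) o - T (a c • (T ^ (c.rev : ℕ)) o)
        = (2 * a c) • EuclideanSpace.single c.rev (1 : ℝ) := by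
      intro c
      rw [map_smul, ← smul_sub, ← Module.End.mul_apply, ← pow_succ', pow_succ,
        Module.End.mul_apply, ← map_sub, hTo, map_smul, negacyclicShift_pow_single, smul_smul,
        mul_comm]
    simp only [ha] at this
    simp only [this]
    ext i
    simp [Pi.single_apply, eq_comm]
    rw [Finset.sum_eq_single i.rev (fun b _ hb => if_neg fun h => hb (by rw [h, Fin.rev_rev]))
      (by simp), if_pos (by simp)]
  have hN : (0 : ℝ) < n + 1 := by positivity
  have h1 : ∑ c, a c = 1 := by
    simp only [ha]
    rw [sum_comm]
    simp [factor_row_sum]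
  have h2 : ∑ c, a c ^ 2 ≤ 1 / ((n : ℝ) + 1) := by
    rw [hg, hy0, EuclideanSpace.norm_sq_eq, sub_zero, EuclideanSpace.norm_sq_eq] at hrate
    simp only [Real.norm_eq_abs, sq_abs, mul_pow, ← mul_sum] at hrate
    rw [sum_rev (fun i => a i ^ 2)] at hrate
    simp only [ho, one_pow, sum_const, card_univ, Fintype.card_fin, nsmul_eq_mul] at hrate
    rw [le_div_iff₀ (by positivity)] at hrate ⊢
    push_cast at hrate
    nlinarith
  have h3 : ∑ c, (a c - 1 / ((n : ℝ) + 1)) ^ 2 ≤ 0 := by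
    have : ∀ c, (a c - 1 / ((n : ℝ) + 1)) ^ 2
        = a c ^ 2 - 2 / ((n : ℝ) + 1) * a c + (1 / ((n : ℝ) + 1)) ^ 2 := fun c => by ring
    simp only [this, sum_add_distrib, sum_sub_distrib, ← mul_sum, h1, sum_const, card_univ,
      Fintype.card_fin, nsmul_eq_mul]
    have : ((n + 1 : ℕ) : ℝ) * (1 / ((n : ℝ) + 1)) ^ 2 = 1 / ((n : ℝ) + 1) := by
      push_cast; field_simp
    rw [this]
    have : 2 / ((n : ℝ) + 1) = 2 * (1 / ((n : ℝ) + 1)) := by ring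
    rw [this]
    linarith
  have h4 := (sum_eq_zero_iff_of_nonneg (fun c _ => sq_nonneg (a c - 1 / ((n : ℝ) + 1)))).mp
    (le_antisymm h3 (sum_nonneg fun c _ => sq_nonneg _)) c (mem_univ c)
  exact sub_eq_zero.mp (pow_eq_zero_iff two_ne_zero |>.mp h4)

lemma isNormalized_factor {H : Matrix (Fin n) (Fin n) ℝ} (hl : IsLower H)
    (hcol : ∀ c, ∑ j, factor H j c = 1 / ((n : ℝ) + 1)) : IsNormalized (factor H) where
  upper := factor_upper hl
  row := factor_row_sum
  col := hcol
  diag j := by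
    induction j using Fin.induction with
    | zero =>
      have h := hcol 0
      rw [Finset.sum_eq_single 0 (fun j _ hj => factor_upper hl j 0 (Fin.pos_of_ne_zero hj))
        (by simp)] at h
      rw [h]; positivity
    | succ j ih =>
      have h := congrFun (congrFun (factor_mul_strictUpperOnes hl) j.castSucc) j.succ
      rw [mul_strictUpperOnes_apply, Matrix.mul_apply, Finset.sum_eq_single j.castSucc,
        Finset.sum_eq_single j.succ] at h
      · intro h0
        rw [h0, mul_zero] at h
        exact ih h
      · intro k _ hk
        rcases lt_or_gt_of_ne hk with h | h
        · rw [stepCum_of_le hl (Fin.le_castSucc_iff.mpr h), zero_mul]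
        · rw [factor_upper hl k _ h, mul_zero]
      · simp
      · intro b hb hne
        refine factor_upper hl _ _ (lt_of_le_of_ne (Fin.le_castSucc_iff.mpr ?_) hne)
        simpa using hb
      · simp

/-! ### Sufficiency of the conditions on the factor -/

lemma IsNormalized.sum_row_dotProduct {V : Matrix (Fin (n + 1)) (Fin (n + 1)) ℝ}
    (hV : IsNormalized V) (j : Fin (n + 1)) :
    ∑ k, V j ⬝ᵥ V k = if j = Fin.last n then 1 / ((n : ℝ) + 1) else 0 := by
  simp only [dotProduct]
  rw [sum_comm]
  simp only [← mul_sum, hV.col, ← sum_mul, hV.row]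
  simp

lemma sum_mul_norm_sq {X ι κ : Type*} [NormedAddCommGroup X] [InnerProductSpace ℝ X] [Fintype ι]
    [Fintype κ] (V : Matrix ι κ ℝ) (z : ι → X) :
    ∑ a, ‖∑ j, V j a • z j‖ ^ 2 = ∑ j, ∑ k, V j ⬝ᵥ V k * inner ℝ (z j) (z k) := by
  have h1 : ∀ a, ‖∑ j, V j a • z j‖ ^ 2
      = ∑ j, ∑ k, V j a * V k a * inner ℝ (z j) (z k) := by
    intro a
    rw [← real_inner_self_eq_norm_sq, sum_inner]
    simp only [inner_sum, real_inner_smul_left, real_inner_smul_right]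
    exact sum_congr rfl fun j _ => sum_congr rfl fun k _ => by ring
  simp only [h1, dotProduct, sum_mul]
  rw [sum_comm]
  exact sum_congr rfl fun j _ => sum_comm

/-- With `η_a = ∑_j V_{ja} (y_j - y⋆)`, the iteration turns into the chain
`η_{a+1} = ∑_j V_{ja} (T y_j - y⋆)`, starting at `(y_0 - y⋆) / N` and ending at
`(y_0 - y⋆) / N - (y_{N-1} - T y_{N-1})`.  The obtuse angles between the rows of `V` make
`∑_a (‖η_a‖² - ‖η_{a+1}‖²)` a nonnegative combination of the inequalities expressing that `T` is
nonexpansive, so the last vector is at most as long as the first one. -/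
theorem mem_HStar_of_isOptimalFactor {H : Matrix (Fin n) (Fin n) ℝ} (hl : IsLower H)
    (hV : IsOptimalFactor (factor H)) : H ∈ HStar n := by
  refine ⟨hl, fun X _ _ _ T p y hT hp hy => ?_⟩
  rw [isIterates_iff hl] at hy
  have hN : (0 : ℝ) < n + 1 := by positivity
  set V := factor H with hVdef
  set z : Fin (n + 1) → X := fun j => y j - p with hz
  set g : Fin (n + 1) → X := fun j => y j - T (y j) with hg
  set γ : Fin (n + 1) → X := fun a => ∑ j, V j a • g j with hγ
  set η : ℕ → X := fun a => (1 / ((n : ℝ) + 1)) • z 0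
    - ∑ b ∈ univ.filter (fun b : Fin (n + 1) => (b : ℕ) < a), γ b with hη
  have hη0 : η 0 = (1 / ((n : ℝ) + 1)) • z 0 := by simp [hη]
  have hηlast : η (n + 1) = (1 / ((n : ℝ) + 1)) • z 0 - g (Fin.last n) := by
    have : univ.filter (fun b : Fin (n + 1) => (b : ℕ) < n + 1) = univ := by
      ext b
      simp only [mem_filter, mem_univ, true_and, iff_true]
      exact b.2
    simp only [hη, this, hγ]
    rw [sum_comm]
    simp only [← sum_smul, hV.row]
    simp
  have hη1 : ∀ a : Fin (n + 1), ∑ j, V j a • z j = η a := by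
    intro a
    have hzj : ∀ j, z j = z 0 - ∑ i, stepCum H i j • g i := fun j => by
      simp only [hz]; rw [hy j]; abel
    have hB : ∀ i, ∑ j, stepCum H i j * V j a
        = ∑ b ∈ univ.filter (fun b => b < a), V i b := fun i => by
      rw [← mul_strictUpperOnes_apply, factor_mul_strictUpperOnes hl, Matrix.mul_apply]
    rw [sum_congr rfl fun j _ => by rw [hzj j]]
    simp only [smul_sub, sum_sub_distrib, ← sum_smul, hV.col, hη, hγ, smul_sum, smul_smul]
    congr 1
    rw [sum_comm, sum_comm (s := univ.filter _)]
    refine sum_congr rfl fun i _ => ?_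
    rw [← sum_smul, ← sum_smul]
    congr 1
    rw [← sum_congr rfl fun j _ => mul_comm (stepCum H i j) (V j a), hB]
    rfl
  have hη2 : ∀ a : Fin (n + 1), ∑ j, V j a • (z j - g j) = η (a + 1) := by
    intro a
    simp only [smul_sub, sum_sub_distrib, hη1]
    have : univ.filter (fun b : Fin (n + 1) => (b : ℕ) < a + 1)
        = insert a (univ.filter (fun b : Fin (n + 1) => (b : ℕ) < a)) := by
      ext b; simp only [mem_filter, mem_univ, true_and, mem_insert, Fin.ext_iff]; omega
    simp only [hη, this]
    rw [sum_insert (by simp)]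
    simp only [hγ]
    abel
  set φ : Fin (n + 1) → Fin (n + 1) → ℝ :=
    fun j k => inner ℝ (z j) (z k) - inner ℝ (z j - g j) (z k - g k) with hφ
  have htel : ∑ j, ∑ k, V j ⬝ᵥ V k * φ j k = ‖η 0‖ ^ 2 - ‖η (n + 1)‖ ^ 2 := by
    rw [← Finset.sum_range_sub' (fun a => ‖η a‖ ^ 2) (n + 1),
      ← Fin.sum_univ_eq_sum_range (fun a => ‖η a‖ ^ 2 - ‖η (a + 1)‖ ^ 2)]
    simp only [← hη1, ← hη2, sum_sub_distrib, sum_mul_norm_sq, hφ, mul_sub]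
  have hzg : ∀ j, z j - g j = T (y j) - p := fun j => by simp [hz, hg]
  have hI : ∀ j k, 0 ≤ φ j j + φ k k - 2 * φ j k := by
    intro j k
    have h1 : φ j j + φ k k - 2 * φ j k
        = ‖z j - z k‖ ^ 2 - ‖(z j - g j) - (z k - g k)‖ ^ 2 := by
      rw [@norm_sub_sq ℝ _ _ _ _ (z j) (z k), @norm_sub_sq ℝ _ _ _ _ (z j - g j) (z k - g k)]
      simp only [hφ, real_inner_self_eq_norm_sq, RCLike.re_to_real]
      ring
    rw [h1, hzg, hzg]
    simp only [hz, sub_sub_sub_cancel_right]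
    exact sub_nonneg.mpr (pow_le_pow_left₀ (norm_nonneg _) (hT _ _) 2)
  have hφn : 0 ≤ φ (Fin.last n) (Fin.last n) := by
    simp only [hφ, real_inner_self_eq_norm_sq]
    rw [hzg]
    have := hT (y (Fin.last n)) p
    rw [hp] at this
    exact sub_nonneg.mpr (pow_le_pow_left₀ (norm_nonneg _) this 2)
  have hpos : 0 ≤ ∑ j, ∑ k, V j ⬝ᵥ V k * φ j k := by
    have e1 : ∀ j k, V j ⬝ᵥ V k * φ j k = 1 / 2 * (V j ⬝ᵥ V k * φ j j)
        + 1 / 2 * (V k ⬝ᵥ V j * φ k k)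
        + 1 / 2 * -(V j ⬝ᵥ V k * (φ j j + φ k k - 2 * φ j k)) := by
      intro j k
      rw [dotProduct_comm (V k)]; ring
    simp only [sum_congr rfl fun j _ => sum_congr rfl fun k _ => e1 j k, sum_add_distrib]
    rw [sum_comm (f := fun j k => 1 / 2 * (V k ⬝ᵥ V j * φ k k))]
    simp only [← mul_sum, ← sum_mul, hV.toIsNormalized.sum_row_dotProduct, ite_mul, zero_mul,
      sum_ite_eq', mem_univ, if_true]
    have h2 : 0 ≤ ∑ j, ∑ k, -(V j ⬝ᵥ V k * (φ j j + φ k k - 2 * φ j k)) := by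
      refine sum_nonneg fun j _ => sum_nonneg fun k _ => ?_
      rcases eq_or_ne j k with rfl | hjk
      · ring_nf; rfl
      · rw [neg_nonneg]
        exact mul_nonpos_of_nonpos_of_nonneg (hV.obtuse j k hjk) (hI j k)
    positivity
  have hle : ‖η (n + 1)‖ ≤ ‖η 0‖ := by
    refine le_of_sq_le_sq ?_ (norm_nonneg _)
    rw [htel] at hpos
    linarith
  have hfin : ‖g (Fin.last n)‖ ≤ 2 * ‖z 0‖ / (n + 1) := by
    have : g (Fin.last n) = η 0 - η (n + 1) := by rw [hη0, hηlast]; abel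
    rw [this]
    calc _ ≤ ‖η 0‖ + ‖η (n + 1)‖ := norm_sub_le _ _
      _ ≤ 2 * ‖η 0‖ := by linarith
      _ = _ := by
        rw [hη0, norm_smul, Real.norm_of_nonneg (by positivity)]; ring
  calc ‖g (Fin.last n)‖ ^ 2 ≤ (2 * ‖z 0‖ / (n + 1)) ^ 2 := pow_le_pow_left₀ (norm_nonneg _) hfin 2
    _ = _ := by rw [div_pow, mul_pow]; norm_num [hz]

/-! ### Necessity of the sign conditions -/

namespace IsNormalized

variable {V : Matrix (Fin (n + 1)) (Fin (n + 1)) ℝ} (hV : IsNormalized V)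
include hV

lemma blockTriangular : V.BlockTriangular id := fun j k h => hV.upper j k h

lemma isUnit_det : IsUnit V.det := by
  rw [Matrix.det_of_isUpperTriangular hV.blockTriangular, isUnit_iff_ne_zero]
  exact prod_ne_zero_iff.mpr fun j _ => hV.diag j

lemma mul_inv : V * V⁻¹ = 1 := Matrix.mul_nonsing_inv V hV.isUnit_det

lemma inv_mul : V⁻¹ * V = 1 := Matrix.nonsing_inv_mul V hV.isUnit_det

lemma inv_upper (j k : Fin (n + 1)) (h : k < j) : V⁻¹ j k = 0 := by
  have := hV.isUnit_det.invertible
  have := V.invertibleOfIsUnitDet hV.isUnit_det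
  exact Matrix.blockTriangular_inv_of_blockTriangular hV.blockTriangular h

lemma inv_last (b : Fin (n + 1)) : V⁻¹ b (Fin.last n) = 1 := by
  have h1 : V *ᵥ (fun _ => 1) = Pi.single (Fin.last n) 1 := by
    ext j; simp [Matrix.mulVec, dotProduct, hV.row, Pi.single_apply]
  have h2 : V⁻¹ *ᵥ Pi.single (Fin.last n) 1 = fun _ => 1 := by
    rw [← h1, Matrix.mulVec_mulVec, hV.inv_mul, Matrix.one_mulVec]
  simpa using congrFun h2 b

lemma inv_col_sum (k : Fin (n + 1)) : ∑ b, V⁻¹ b k = n + 1 := by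
  have h1 : (fun _ => (n : ℝ) + 1) ᵥ* V = fun _ => 1 := by
    ext j
    simp only [Matrix.vecMul, dotProduct, ← mul_sum, hV.col]
    field_simp
  have h2 : (fun _ => 1) ᵥ* V⁻¹ = fun _ => (n : ℝ) + 1 := by
    rw [← h1, Matrix.vecMul_vecMul, hV.mul_inv, Matrix.vecMul_one]
  simpa [Matrix.vecMul, dotProduct] using congrFun h2 k

lemma inv_zero (b : Fin (n + 1)) : V⁻¹ b 0 = if b = 0 then (n : ℝ) + 1 else 0 := by
  split_ifs with h
  · rw [h, ← hV.inv_col_sum 0]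
    exact (Finset.sum_eq_single 0 (fun b _ hb => hV.inv_upper b 0 (Fin.pos_of_ne_zero hb))
      (by simp)).symm
  · exact hV.inv_upper b 0 (Fin.pos_of_ne_zero h)

end IsNormalized

/-- The points `y_j = ∑_b V⁻¹_{bj} Y_b` are the iterates of every operator mapping each of them to
`∑_b V⁻¹_{bj} Y_{b+1}`. -/
lemma isIterates_of_chain {X : Type} [NormedAddCommGroup X] [InnerProductSpace ℝ X]
    {H : Matrix (Fin n) (Fin n) ℝ} (hl : IsLower H) (hV : IsNormalized (factor H)) (T : X → X)
    (Y : ℕ → X)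
    (hT : ∀ j, T (∑ b : Fin (n + 1), (factor H)⁻¹ b j • Y b)
      = ∑ b : Fin (n + 1), (factor H)⁻¹ b j • Y (b + 1)) :
    IsIterates H T fun j => ∑ b : Fin (n + 1), (factor H)⁻¹ b j • Y b := by
  rw [isIterates_iff hl]
  intro k
  set W := (factor H)⁻¹ with hW
  have hUW : strictUpperOnes (n + 1) * W = W * stepCum H := by
    calc _ = (W * factor H) * strictUpperOnes (n + 1) * W := by rw [hV.inv_mul, one_mul]
      _ = W * (factor H * strictUpperOnes (n + 1)) * W := by simp only [mul_assoc]
      _ = W * stepCum H * (factor H * W) := by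
        rw [factor_mul_strictUpperOnes hl]; simp only [mul_assoc]
      _ = _ := by rw [hV.mul_inv, mul_one]
  have hWB : ∀ b, ∑ i, W b i * stepCum H i k = ∑ c, if b < c then W c k else 0 := by
    intro b
    have := congrFun (congrFun hUW b) k
    simp only [Matrix.mul_apply, strictUpperOnes, Matrix.of_apply, ite_mul, one_mul, zero_mul]
      at this
    exact this.symm
  have hsum : ∑ i, stepCum H i k • ∑ b : Fin (n + 1), W b i • (Y b - Y (b + 1))
      = ∑ c : Fin (n + 1), W c k • (Y 0 - Y c) := by
    simp only [smul_sum, smul_smul]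
    rw [sum_comm]
    have : ∀ b : Fin (n + 1), ∑ i, (stepCum H i k * W b i) • (Y b - Y (b + 1))
        = ∑ c, if b < c then W c k • (Y b - Y (b + 1)) else 0 := by
      intro b
      rw [← sum_smul, ← sum_congr rfl fun i _ => mul_comm (W b i) (stepCum H i k), hWB, sum_smul]
      simp only [ite_smul, zero_smul]
    rw [sum_congr rfl fun b _ => this b, sum_comm]
    refine sum_congr rfl fun c _ => ?_
    rw [← sum_filter, ← smul_sum, sum_fin_lt c (fun b => Y b - Y (b + 1)),
      Finset.sum_range_sub']
  have hsub : ∀ i, ∑ b : Fin (n + 1), W b i • Y b - ∑ b : Fin (n + 1), W b i • Y (b + 1)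
      = ∑ b : Fin (n + 1), W b i • (Y b - Y (b + 1)) := by
    intro i
    simp only [smul_sub, sum_sub_distrib]
  simp only [hT, hsub, hsum]
  rw [sum_congr rfl fun c _ => smul_sub (W c k) (Y 0) (Y c), sum_sub_distrib, ← sum_smul,
    hV.inv_col_sum]
  simp only [hW, hV.inv_zero, ite_smul, zero_smul, sum_ite_eq', mem_univ, if_true, Fin.val_zero]
  abel

/-- The sign vectors whose Gram matrix is the Toeplitz part of the worst-case Gram matrix: entry
`c` of vector `a` is negative exactly when `c < a`. -/
def signVec (n : ℕ) : Matrix (Fin (n + 1)) (Fin (n + 2)) ℝ :=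
  Matrix.of fun c a => if (c : ℕ) < a then -1 else 1

/-- The perturbation of the worst-case Gram matrix attached to the rows `u` and `v`: it vanishes in
its first row and column, and moving down a diagonal from `(a, b)` adds
`(u a * v b + v a * u b) / 2`. -/
def perturbation (u v : Fin (n + 1) → ℝ) : Matrix (Fin (n + 2)) (Fin (n + 2)) ℝ :=
  Matrix.of fun a b => ∑ c : Fin (n + 1), ∑ d : Fin (n + 1),
    if (c : ℕ) < a ∧ (a : ℕ) + d = b + c then (u c * v d + v c * u d) / 2 else 0

lemma perturbation_succ (u v : Fin (n + 1) → ℝ) (a b : Fin (n + 1)) :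
    perturbation u v a.succ b.succ
      = perturbation u v a.castSucc b.castSucc + (u a * v b + v a * u b) / 2 := by
  have h1 : (u a * v b + v a * u b) / 2 = ∑ c : Fin (n + 1), ∑ d : Fin (n + 1),
      if c = a ∧ d = b then (u c * v d + v c * u d) / 2 else 0 := by
    rw [Finset.sum_eq_single a, Finset.sum_eq_single b] <;> simp +contextual
  rw [h1]
  simp only [perturbation, Matrix.of_apply, ← sum_add_distrib]
  refine sum_congr rfl fun c _ => sum_congr rfl fun d _ => ?_
  simp only [Fin.val_succ, Fin.val_castSucc, Fin.ext_iff]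
  by_cases h : (c : ℕ) = a ∧ (d : ℕ) = b
  · rw [if_pos (by omega), if_neg (by omega), if_pos h, zero_add]
  · rw [if_neg h, add_zero]
    exact if_congr (by omega) rfl rfl

lemma isHermitian_perturbation (u v : Fin (n + 1) → ℝ) : (perturbation u v).IsHermitian := by
  ext a b
  simp only [Matrix.conjTranspose_apply, star_trivial, perturbation, Matrix.of_apply]
  rw [sum_comm]
  refine sum_congr rfl fun c _ => sum_congr rfl fun d _ => ?_
  rw [show (u d * v c + v d * u c) / 2 = (u c * v d + v c * u d) / 2 by ring]
  exact if_congr (by omega) rfl rfl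

lemma perturbation_zero (u v : Fin (n + 1) → ℝ) (b : Fin (n + 2)) :
    perturbation u v 0 b = 0 := by
  simp [perturbation]

lemma perturbation_last (u v : Fin (n + 1) → ℝ) :
    perturbation u v (Fin.last (n + 1)) (Fin.last (n + 1)) = u ⬝ᵥ v := by
  simp only [perturbation, Matrix.of_apply, dotProduct]
  refine sum_congr rfl fun c _ => ?_
  rw [Finset.sum_eq_single c]
  · rw [if_pos ⟨c.2, rfl⟩]; ring
  · intro d _ hd
    rw [if_neg]
    rintro ⟨-, h⟩
    exact hd (Fin.ext (by omega))
  · simp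

lemma signVec_gram_succ (a b : Fin (n + 1)) :
    ((signVec n)ᵀ * signVec n) a.succ b.succ = ((signVec n)ᵀ * signVec n) a.castSucc b.castSucc := by
  simp only [Matrix.mul_apply, Matrix.transpose_apply, signVec, Matrix.of_apply]
  rw [Fin.sum_univ_succ, Fin.sum_univ_castSucc]
  simp only [Fin.val_succ, Fin.val_castSucc, Fin.val_zero, Fin.val_last]
  rw [if_neg (by omega), if_neg (by omega), add_comm]
  simp

/-- The Gram matrix of the sign vectors has the one-dimensional kernel spanned by the sum of the
first and the last basis vectors. -/
lemma eq_zero_of_signVec_mulVec {x : Fin (n + 2) → ℝ} (hx : signVec n *ᵥ x = 0) :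
    (∀ i : Fin n, x i.castSucc.succ = 0) ∧ x (Fin.last (n + 1)) = x 0 := by
  have h : ∀ c : Fin (n + 1), ∑ a : Fin (n + 2), (if (c : ℕ) < a then -1 else 1) * x a = 0 :=
    fun c => congrFun hx c
  have h1 : ∀ i : Fin n, x i.castSucc.succ = 0 := by
    intro i
    have h2 := h i.succ
    have h3 := h i.castSucc
    have h4 : ∑ a : Fin (n + 2), ((if (i.succ : ℕ) < a then -1 else 1) * x a
        - (if (i.castSucc : ℕ) < a then -1 else 1) * x a) = 2 * x i.castSucc.succ := by
      rw [Finset.sum_eq_single i.castSucc.succ]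
      · simp; ring
      · intro a _ ha
        have ha' : (a : ℕ) ≠ i + 1 := fun h => ha (Fin.ext (by simpa using h))
        simp only [Fin.val_succ, Fin.val_castSucc]
        split_ifs <;> first | omega | ring
      · simp
    rw [sum_sub_distrib, h2, h3] at h4
    linarith
  refine ⟨h1, ?_⟩
  have h0 := h 0
  rw [Fin.sum_univ_succ, Fin.sum_univ_castSucc] at h0
  simp only [h1] at h0
  simp at h0
  linarith

/-- A pair of rows of the factor at an acute angle yields a nonexpansive operator on which the
method is worse than optimal. -/
theorem factor_obtuse {H : Matrix (Fin n) (Fin n) ℝ} (hH : H ∈ HStar n) (p q : Fin (n + 1))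
    (hpq : p ≠ q) : factor H p ⬝ᵥ factor H q ≤ 0 := by
  by_contra! hpos
  have hl : IsLower H := hH.1
  have hV := isNormalized_factor hl (factor_col_sum hH)
  set V := factor H with hVdef
  set P := (signVec n)ᵀ * signVec n with hP
  set Q := perturbation (V p) (V q) with hQ
  have hPform : ∀ x, x ⬝ᵥ P *ᵥ x = (signVec n *ᵥ x) ⬝ᵥ (signVec n *ᵥ x) := by
    intro x
    rw [hP, ← Matrix.mulVec_mulVec, Matrix.dotProduct_mulVec, Matrix.vecMul_transpose]
  have hPpsd : P.PosSemidef := by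
    have := Matrix.posSemidef_conjTranspose_mul_self (signVec n)
    rwa [Matrix.conjTranspose_eq_transpose_of_trivial] at this
  have hQ0 : ∀ b, Q 0 b = 0 := fun b => perturbation_zero _ _ b
  have hQs : ∀ a b, Q a b = Q b a := fun a b => by
    simpa using congrFun (congrFun (isHermitian_perturbation (V p) (V q)) b) a
  obtain ⟨K, hK, hpsd⟩ := exists_posSemidef_smul_add hPpsd (isHermitian_perturbation (V p) (V q)) (by
    intro x hx0 hx
    rw [hPform, dotProduct_self_eq_zero] at hx
    obtain ⟨h1, h2⟩ := eq_zero_of_signVec_mulVec hx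
    have hx00 : x 0 ≠ 0 := by
      intro h
      refine hx0 (funext fun i => ?_)
      cases i using Fin.cases with
      | zero => exact h
      | succ i =>
        cases i using Fin.lastCases with
        | last => rw [Fin.succ_last, h2, h]; rfl
        | cast i => exact h1 i
    have hval : x ⬝ᵥ Q *ᵥ x = x 0 ^ 2 * (V p ⬝ᵥ V q) := by
      rw [← perturbation_last (V p) (V q), ← hQ]
      have hends : ∀ f : Fin (n + 2) → ℝ, (∀ i : Fin n, f i.castSucc.succ = 0) →
          ∑ a, f a = f 0 + f (Fin.last (n + 1)) := by
        intro f hf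
        rw [Fin.sum_univ_succ, Fin.sum_univ_castSucc]
        simp [hf]
      simp only [dotProduct, Matrix.mulVec]
      rw [hends _ fun i => by rw [h1, zero_mul], hends _ fun i => by rw [h1, mul_zero],
        hends _ fun i => by rw [h1, mul_zero], hQ0, hQ0, hQs _ 0, hQ0, h2]
      ring
    rw [hval]
    positivity)
  obtain ⟨Y', hY'⟩ := exists_gram hpsd
  set Y : ℕ → EuclideanSpace ℝ (Fin (n + 2)) := fun k => if h : k < n + 2 then Y' ⟨k, h⟩ else 0
    with hY
  have hYc : ∀ a : Fin (n + 1), Y a = Y' a.castSucc := fun a => by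
    have : (a : ℕ) < n + 2 := by omega
    simp only [hY, this, dif_pos]; rfl
  have hYs : ∀ a : Fin (n + 1), Y (a + 1) = Y' a.succ := fun a => by
    have : (a : ℕ) + 1 < n + 2 := by omega
    simp only [hY, this, dif_pos]; rfl
  -- moving along the chain changes squared lengths by the product of two rows of `V`
  have hform : ∀ w : Fin (n + 1) → ℝ, ‖∑ a : Fin (n + 1), w a • Y (a + 1)‖ ^ 2
      = ‖∑ a : Fin (n + 1), w a • Y a‖ ^ 2 + (V p ⬝ᵥ w) * (V q ⬝ᵥ w) := by
    intro w
    have hn : ∀ Z : Fin (n + 1) → EuclideanSpace ℝ (Fin (n + 2)), ‖∑ a, w a • Z a‖ ^ 2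
        = ∑ a, ∑ b, w a * w b * inner ℝ (Z a) (Z b) := by
      intro Z
      rw [← real_inner_self_eq_norm_sq, sum_inner]
      simp only [inner_sum, real_inner_smul_left, real_inner_smul_right]
      exact sum_congr rfl fun j _ => sum_congr rfl fun k _ => by ring
    have hprod : (V p ⬝ᵥ w) * (V q ⬝ᵥ w) = ∑ a, ∑ b,
        w a * w b * ((V p a * V q b + V q a * V p b) / 2) := by
      have e1 : (V p ⬝ᵥ w) * (V q ⬝ᵥ w) = ∑ a, ∑ b, w a * w b * (V p a * V q b) := by
        simp only [dotProduct, sum_mul_sum]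
        exact sum_congr rfl fun j _ => sum_congr rfl fun k _ => by ring
      have e2 : (V p ⬝ᵥ w) * (V q ⬝ᵥ w) = ∑ a, ∑ b, w a * w b * (V q a * V p b) := by
        rw [mul_comm]
        simp only [dotProduct, sum_mul_sum]
        exact sum_congr rfl fun j _ => sum_congr rfl fun k _ => by ring
      have e3 : ∑ a, ∑ b, w a * w b * ((V p a * V q b + V q a * V p b) / 2)
          = (∑ a, ∑ b, w a * w b * (V p a * V q b) + ∑ a, ∑ b, w a * w b * (V q a * V p b)) / 2 := by
        simp only [← sum_add_distrib, sum_div]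
        exact sum_congr rfl fun j _ => sum_congr rfl fun k _ => by ring
      rw [e3, ← e1, ← e2]; ring
    rw [hn (fun a => Y (a + 1)), hn (fun a => Y a), hprod]
    simp only [← sum_add_distrib]
    refine sum_congr rfl fun a _ => sum_congr rfl fun b _ => ?_
    rw [hYc, hYc, hYs, hYs, hY', hY', Matrix.add_apply, Matrix.add_apply, Matrix.smul_apply,
      Matrix.smul_apply, hP, signVec_gram_succ, perturbation_succ]
    ring
  set W := V⁻¹ with hW
  set y : Fin (n + 1) → EuclideanSpace ℝ (Fin (n + 2)) :=
    fun j => ∑ b : Fin (n + 1), W b j • Y b with hy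
  set t : Fin (n + 1) → EuclideanSpace ℝ (Fin (n + 2)) :=
    fun j => ∑ b : Fin (n + 1), W b j • Y (b + 1) with ht
  have hVW : ∀ i j, V i ⬝ᵥ (fun b => W b j) = if i = j then 1 else 0 := fun i j => by
    have := congrFun (congrFun hV.mul_inv i) j
    rw [Matrix.mul_apply, Matrix.one_apply] at this
    exact this
  have hnorm : ∀ j, ‖t j‖ ≤ ‖y j‖ := by
    intro j
    refine le_of_sq_le_sq ?_ (norm_nonneg _)
    simp only [ht, hy]
    rw [hform (fun b => W b j), hVW, hVW]
    have : (if p = j then (1 : ℝ) else 0) * (if q = j then 1 else 0) = 0 := by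
      split_ifs with h1 h2
      · exact absurd (h1.trans h2.symm) hpq
      all_goals simp
    rw [this, add_zero]
  have hdist : ∀ i j, ‖t i - t j‖ ≤ ‖y i - y j‖ := by
    intro i j
    refine le_of_sq_le_sq ?_ (norm_nonneg _)
    simp only [ht, hy, ← sum_sub_distrib, ← sub_smul]
    rw [hform (fun b => W b i - W b j)]
    have hd : ∀ k, V k ⬝ᵥ (fun b => W b i - W b j)
        = (if k = i then 1 else 0) - (if k = j then 1 else 0) := by
      intro k
      rw [← hVW, ← hVW, ← dotProduct_sub]; rfl
    rw [hd, hd]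
    have : ((if p = i then (1 : ℝ) else 0) - if p = j then 1 else 0)
        * ((if q = i then 1 else 0) - if q = j then 1 else 0) ≤ 0 := by
      split_ifs with h1 h2 h3 h4 h5 h6 <;> first | (exfalso; apply hpq; simp_all; done) | norm_num
    linarith
  obtain ⟨T, hTne, hTS⟩ := exists_nonexpansive_extension
    (insert (0, 0) (Set.range fun j => (y j, t j))) (by
      rintro a (rfl | ⟨i, rfl⟩) b (rfl | ⟨j, rfl⟩)
      · simp
      · simpa using hnorm j
      · simpa using hnorm i
      · exact hdist i j)
  have hTy : ∀ j, T (y j) = t j := fun j => hTS (y j, t j) (Or.inr ⟨j, rfl⟩)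
  have hT0 : T 0 = 0 := hTS (0, 0) (Or.inl rfl)
  have hrate := hH.2 _ T 0 y hTne hT0 (isIterates_of_chain hl hV T Y hTy)
  have hlast : y (Fin.last n) - T (y (Fin.last n)) = Y 0 - Y (n + 1) := by
    rw [hTy]
    simp only [hy, ht, hW, hV.inv_last, one_smul, ← sum_sub_distrib]
    rw [Fin.sum_univ_eq_sum_range (fun b => Y b - Y (b + 1)), Finset.sum_range_sub']
  have hy0 : y 0 = ((n : ℝ) + 1) • Y 0 := by
    simp [hy, hW, hV.inv_zero]
  have hN : (0 : ℝ) < n + 1 := by positivity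
  rw [hlast, hy0, sub_zero, norm_smul, Real.norm_of_nonneg hN.le, mul_pow, @norm_sub_sq ℝ] at hrate
  have e0 : Y 0 = Y' 0 := hYc 0
  have e1 : Y (n + 1) = Y' (Fin.last (n + 1)) := hYs (Fin.last n)
  have hle : ∀ c : Fin (n + 1), (c : ℕ) ≤ n := fun c => Nat.lt_succ_iff.mp c.2
  have hP00 : P 0 0 = n + 1 := by simp [hP, Matrix.mul_apply, signVec]
  have hP0l : P 0 (Fin.last (n + 1)) = -(n + 1) := by
    simp [hP, Matrix.mul_apply, signVec, hle]
  have hPll : P (Fin.last (n + 1)) (Fin.last (n + 1)) = n + 1 := by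
    simp [hP, Matrix.mul_apply, signVec, hle]
  have hQll : Q (Fin.last (n + 1)) (Fin.last (n + 1)) = V p ⬝ᵥ V q := perturbation_last _ _
  rw [← real_inner_self_eq_norm_sq, ← real_inner_self_eq_norm_sq, RCLike.re_to_real, e0, e1,
    hY', hY', hY'] at hrate
  simp only [Matrix.add_apply, Matrix.smul_apply, smul_eq_mul, hP00, hP0l, hPll, ← hQ, hQ0, hQll]
    at hrate
  rw [le_div_iff₀ (by positivity)] at hrate
  have : 0 < (V p ⬝ᵥ V q) * ((n : ℝ) + 1) ^ 2 := by positivity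
  nlinarith

/-- Minimax optimality of an H-matrix in terms of its factor. -/
theorem mem_HStar_iff {H : Matrix (Fin n) (Fin n) ℝ} :
    H ∈ HStar n ↔ IsLower H ∧ IsOptimalFactor (factor H) :=
  ⟨fun h => ⟨h.1, isNormalized_factor h.1 (factor_col_sum h), factor_obtuse h⟩,
    fun h => mem_HStar_of_isOptimalFactor h.1 h.2⟩

/-! ### The correspondence between H-matrices and factors -/

lemma eq_zero_of_prefix_sums {x : Fin (n + 1) → ℝ}
    (h : ∀ c, ∑ b ∈ univ.filter (fun b => b < c), x b = 0) (hx : ∑ b, x b = 0) : x = 0 := by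
  have h1 : ∀ i : Fin n, x i.castSucc = 0 := by
    intro i
    have hi : univ.filter (fun b : Fin (n + 1) => b < i.succ)
        = insert i.castSucc (univ.filter (fun b => b < i.castSucc)) := by
      ext b
      simp only [mem_filter, mem_univ, true_and, mem_insert, Fin.lt_def, Fin.ext_iff,
        Fin.val_castSucc, Fin.val_succ]
      omega
    have := h i.succ
    rw [hi, sum_insert (by simp), h, add_zero] at this
    exact this
  ext i
  cases i using Fin.lastCases with
  | last => simpa [Fin.sum_univ_castSucc, h1] using hx
  | cast i => exact h1 i

/-- The factor is the only solution of its defining equations. -/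
lemma eq_factor {H : Matrix (Fin n) (Fin n) ℝ} (hH : IsLower H)
    {V : Matrix (Fin (n + 1)) (Fin (n + 1)) ℝ}
    (hV : V * strictUpperOnes (n + 1) = stepCum H * V)
    (hrow : ∀ j, ∑ k, V j k = if j = Fin.last n then 1 else 0) : V = factor H := by
  suffices hX : ∀ j, (V - factor H) j = 0 from sub_eq_zero.mp (funext hX)
  have hU : (V - factor H) * strictUpperOnes (n + 1) = stepCum H * (V - factor H) := by
    rw [sub_mul, mul_sub, hV, factor_mul_strictUpperOnes hH]
  intro j
  induction j using WellFoundedGT.induction with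
  | ind j ih =>
    refine eq_zero_of_prefix_sums (fun c => ?_) ?_
    · rw [← mul_strictUpperOnes_apply, hU, Matrix.mul_apply]
      refine sum_eq_zero fun k _ => ?_
      by_cases hk : k ≤ j
      · rw [stepCum_of_le hH hk, zero_mul]
      · rw [ih k (not_le.mp hk)]; simp
    · simp [sum_sub_distrib, hrow, factor_row_sum]

lemma stepCum_eq_of_isNormalized {H : Matrix (Fin n) (Fin n) ℝ} (hH : IsLower H)
    (hV : IsNormalized (factor H)) :
    stepCum H = factor H * strictUpperOnes (n + 1) * (factor H)⁻¹ := by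
  rw [factor_mul_strictUpperOnes hH, mul_assoc, hV.mul_inv, mul_one]

/-- An H-matrix with a normalized factor is determined by its factor. -/
lemma eq_of_factor_eq {H H' : Matrix (Fin n) (Fin n) ℝ} (hH : IsLower H) (hH' : IsLower H')
    (hV : IsNormalized (factor H)) (h : factor H = factor H') : H = H' := by
  have hB : stepCum H = stepCum H' := by
    rw [stepCum_eq_of_isNormalized hH hV, stepCum_eq_of_isNormalized hH' (h ▸ hV), h]
  ext k j
  have h1 := stepCum_succ_sub H j k
  have h2 := stepCum_succ_sub H' j k
  rw [hB] at h1
  linarith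

/-- Every normalized matrix is the factor of an H-matrix. -/
lemma IsNormalized.exists_factor_eq {V : Matrix (Fin (n + 1)) (Fin (n + 1)) ℝ}
    (hV : IsNormalized V) : ∃ H : Matrix (Fin n) (Fin n) ℝ, IsLower H ∧ factor H = V := by
  set B := V * strictUpperOnes (n + 1) * V⁻¹ with hB
  have hB0 : ∀ j k, k ≤ j → B j k = 0 := by
    intro j k hkj
    rw [hB, Matrix.mul_apply]
    refine sum_eq_zero fun b _ => ?_
    by_cases hb : k < b
    · rw [hV.inv_upper b k hb, mul_zero]
    · rw [mul_strictUpperOnes_apply, sum_eq_zero, zero_mul]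
      intro a ha
      simp only [mem_filter, mem_univ, true_and] at ha
      exact hV.upper j a (lt_of_lt_of_le ha ((not_lt.mp hb).trans hkj))
  set H : Matrix (Fin n) (Fin n) ℝ :=
    Matrix.of fun k j => B j.castSucc k.succ - B j.castSucc k.castSucc with hH
  have hl : IsLower H := by
    intro k j hkj
    simp only [hH, Matrix.of_apply]
    rw [hB0 _ _ (by rw [Fin.le_def]; exact hkj), hB0 _ _ (by rw [Fin.le_def]; exact hkj.le),
      sub_zero]
  have hstep : stepCum H = B := by
    ext j k
    cases j using Fin.lastCases with
    | last => rw [stepCum_last, hB0 _ _ (Fin.le_last k)]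
    | cast j =>
      induction k using Fin.induction with
      | zero => rw [stepCum_zero, hB0 _ _ (Fin.zero_le _)]
      | succ k ih =>
        rw [stepCum_succ_sub, ih]
        simp [hH]
  refine ⟨H, hl, (eq_factor hl ?_ hV.row).symm⟩
  rw [hstep, hB, mul_assoc _ V⁻¹, hV.inv_mul, mul_one]

/-! ### Duality of factors -/

/-- The upper bidiagonal difference matrix. -/
def difference (n : ℕ) : Matrix (Fin n) (Fin n) ℝ :=
  Matrix.of fun i j => if i = j then 1 else if (i : ℕ) + 1 = j then -1 else 0

lemma mul_difference_zero (X : Matrix (Fin (n + 1)) (Fin (n + 1)) ℝ) (j : Fin (n + 1)) :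
    (X * difference (n + 1)) j 0 = X j 0 := by
  rw [Matrix.mul_apply, Finset.sum_eq_single 0]
  · simp [difference]
  · intro b _ hb
    simp [difference, hb]
  · simp

lemma mul_difference_succ (X : Matrix (Fin (n + 1)) (Fin (n + 1)) ℝ) (j : Fin (n + 1))
    (k : Fin n) : (X * difference (n + 1)) j k.succ = X j k.succ - X j k.castSucc := by
  have : ∀ b : Fin (n + 1), X j b * difference (n + 1) b k.succ
      = (if b = k.succ then X j b else 0) - (if b = k.castSucc then X j b else 0) := by
    intro b
    simp only [difference, Matrix.of_apply, Fin.ext_iff, Fin.val_succ, Fin.val_castSucc]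
    split_ifs <;> first | omega | ring
  rw [Matrix.mul_apply, sum_congr rfl fun b _ => this b, sum_sub_distrib]
  simp

lemma difference_mul_last (X : Matrix (Fin (n + 1)) (Fin (n + 1)) ℝ) (k : Fin (n + 1)) :
    (difference (n + 1) * X) (Fin.last n) k = X (Fin.last n) k := by
  rw [Matrix.mul_apply, Finset.sum_eq_single (Fin.last n)]
  · simp [difference]
  · intro b _ hb
    have : n + 1 ≠ b := by omega
    simp [difference, hb.symm, this]
  · simp

lemma difference_mul_castSucc (X : Matrix (Fin (n + 1)) (Fin (n + 1)) ℝ) (j : Fin n)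
    (k : Fin (n + 1)) :
    (difference (n + 1) * X) j.castSucc k = X j.castSucc k - X j.succ k := by
  have : ∀ b : Fin (n + 1), difference (n + 1) j.castSucc b * X b k
      = (if b = j.castSucc then X b k else 0) - (if b = j.succ then X b k else 0) := by
    intro b
    simp only [difference, Matrix.of_apply, Fin.ext_iff, Fin.val_succ, Fin.val_castSucc]
    split_ifs <;> first | omega | ring
  rw [Matrix.mul_apply, sum_congr rfl fun b _ => this b, sum_sub_distrib]
  simp

lemma hDual_apply (X : Matrix (Fin n) (Fin n) ℝ) (i j : Fin n) :
    hDual X i j = X j.rev i.rev := rfl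

@[simp] lemma hDual_hDual (X : Matrix (Fin n) (Fin n) ℝ) : hDual (hDual X) = X := by
  ext; simp [hDual_apply]

lemma hDual_mul (X Y : Matrix (Fin n) (Fin n) ℝ) : hDual (X * Y) = hDual Y * hDual X := by
  ext i j
  simp only [hDual_apply, Matrix.mul_apply]
  rw [← sum_rev]
  exact sum_congr rfl fun k _ => mul_comm _ _

lemma hDual_strictUpperOnes : hDual (strictUpperOnes n) = strictUpperOnes n := by
  ext i j
  simp [hDual_apply, strictUpperOnes]

lemma hDual_difference : hDual (difference n) = difference n := by
  ext i j
  simp only [hDual_apply, difference, Matrix.of_apply, Fin.rev_inj, Fin.val_rev]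
  split_ifs <;> first | rfl | omega

lemma IsLower.hDual {H : Matrix (Fin n) (Fin n) ℝ} (hH : IsLower H) : IsLower (hDual H) :=
  fun i j h => hH j.rev i.rev (Fin.rev_lt_rev.mpr h)

lemma stepCum_mul_difference {H : Matrix (Fin n) (Fin n) ℝ} :
    stepCum H * difference (n + 1) = difference (n + 1) * hDual (stepCum (hDual H)) := by
  ext j k
  cases k using Fin.cases with
  | zero =>
    rw [mul_difference_zero, stepCum_zero]
    cases j using Fin.lastCases with
    | last => rw [difference_mul_last, hDual_apply, Fin.rev_zero, stepCum_last]
    | cast j =>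
      rw [difference_mul_castSucc, hDual_apply, hDual_apply, Fin.rev_zero, stepCum_last,
        stepCum_last, sub_zero]
  | succ k =>
    rw [mul_difference_succ]
    cases j using Fin.lastCases with
    | last =>
      rw [difference_mul_last, hDual_apply, Fin.rev_last, stepCum_zero, stepCum_last,
        stepCum_last, sub_zero]
    | cast j =>
      rw [difference_mul_castSucc, hDual_apply, hDual_apply, Fin.rev_succ, Fin.rev_castSucc,
        Fin.rev_succ, stepCum_succ_sub, stepCum_succ_sub, hDual_apply, Fin.rev_rev, Fin.rev_rev]
      ring

/-- Two factors are dual when their product, one of them anti-transposed, is the difference matrix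
up to the normalization. -/
def IsDualFactor (V V' : Matrix (Fin (n + 1)) (Fin (n + 1)) ℝ) : Prop :=
  V * hDual V' = (1 / ((n : ℝ) + 1)) • difference (n + 1)

lemma IsDualFactor.symm {V V' : Matrix (Fin (n + 1)) (Fin (n + 1)) ℝ} (h : IsDualFactor V V') :
    IsDualFactor V' V := by
  have := congrArg hDual h
  rw [hDual_mul, hDual_hDual] at this
  rw [IsDualFactor, this]
  conv_rhs => rw [← hDual_difference]
  rfl

lemma IsDualFactor.unique {V V₁ V₂ : Matrix (Fin (n + 1)) (Fin (n + 1)) ℝ} (hV : IsNormalized V)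
    (h₁ : IsDualFactor V V₁) (h₂ : IsDualFactor V V₂) : V₁ = V₂ := by
  have h : V * hDual V₁ = V * hDual V₂ := Eq.trans h₁ (Eq.symm h₂)
  have h' : hDual V₁ = hDual V₂ := by
    rw [← one_mul (hDual V₁), ← hV.inv_mul, mul_assoc, h, ← mul_assoc, hV.inv_mul, one_mul]
  rw [← hDual_hDual V₁, h', hDual_hDual]

/-- The factor of the H-dual is the dual of the factor. -/
theorem isDualFactor_factor_hDual {H : Matrix (Fin n) (Fin n) ℝ} (hH : IsLower H)
    (hV : IsNormalized (factor H)) :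
    IsDualFactor (factor H) (factor (hDual H)) ∧ IsNormalized (factor (hDual H)) := by
  set V := factor H with hVdef
  set c : ℝ := 1 / ((n : ℝ) + 1) with hc
  set E := difference (n + 1) with hE
  set V' : Matrix (Fin (n + 1)) (Fin (n + 1)) ℝ := c • hDual (V⁻¹ * E) with hV'
  have hdual : V * hDual V' = c • E := by
    have : hDual V' = c • (V⁻¹ * E) := by
      rw [hV']; ext i j; simp [hDual_apply]
    rw [this, Matrix.mul_smul, ← mul_assoc, hV.mul_inv, one_mul]
  have hUW : strictUpperOnes (n + 1) * V⁻¹ = V⁻¹ * stepCum H := by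
    calc _ = (V⁻¹ * V) * strictUpperOnes (n + 1) * V⁻¹ := by rw [hV.inv_mul, one_mul]
      _ = V⁻¹ * (V * strictUpperOnes (n + 1)) * V⁻¹ := by simp only [mul_assoc]
      _ = V⁻¹ * stepCum H * (V * V⁻¹) := by
        rw [hVdef, factor_mul_strictUpperOnes hH]; simp only [mul_assoc]
      _ = _ := by rw [hV.mul_inv, mul_one]
  have hfac : V' = factor (hDual H) := by
    refine eq_factor hH.hDual ?_ ?_
    · have h1 : hDual (strictUpperOnes (n + 1) * (V⁻¹ * E))
          = hDual (V⁻¹ * E) * strictUpperOnes (n + 1) := by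
        rw [hDual_mul, hDual_strictUpperOnes]
      have h2 : hDual (V⁻¹ * E * hDual (stepCum (hDual H)))
          = stepCum (hDual H) * hDual (V⁻¹ * E) := by
        rw [hDual_mul, hDual_hDual]
      rw [hV', Matrix.smul_mul, Matrix.mul_smul, ← h1, ← h2, mul_assoc V⁻¹ E,
        ← stepCum_mul_difference, ← mul_assoc, hUW, mul_assoc]
    · intro j
      have h1 : ∑ k, V' j k = c * ∑ k, (V⁻¹ * E) k j.rev := by
        simp only [hV', Matrix.smul_apply, hDual_apply, smul_eq_mul, ← mul_sum]
        rw [sum_rev (fun k => (V⁻¹ * E) k j.rev)]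
      rw [h1]
      generalize hk : j.rev = k
      cases k using Fin.cases with
      | zero =>
        have : j = Fin.last n := by rw [← Fin.rev_rev j, hk, Fin.rev_zero]
        rw [sum_congr rfl fun b _ => mul_difference_zero _ b, hV.inv_col_sum, if_pos this, hc]
        field_simp
      | succ k =>
        have : j ≠ Fin.last n := by
          rintro rfl
          rw [Fin.rev_last] at hk
          exact (Fin.succ_ne_zero k) hk.symm
        rw [sum_congr rfl fun b _ => mul_difference_succ _ b k, sum_sub_distrib, hV.inv_col_sum,
          hV.inv_col_sum, if_neg this, sub_self, mul_zero]
  refine ⟨hfac ▸ hdual, isNormalized_factor hH.hDual fun k => ?_⟩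
  rw [← hfac]
  have hrow : ∀ b, ∑ a, (V⁻¹ * E) b a = 1 := by
    intro b
    rw [Fin.sum_univ_succ, mul_difference_zero]
    rw [sum_congr rfl fun k _ => mul_difference_succ _ b k, sum_sub_distrib]
    have h1 := hV.inv_last b
    have h2 := Fin.sum_univ_succ (fun a => V⁻¹ b a)
    rw [Fin.sum_univ_castSucc, h1] at h2
    linarith
  simp only [hV', Matrix.smul_apply, hDual_apply, smul_eq_mul, ← mul_sum]
  rw [sum_rev (fun j => (V⁻¹ * E) k.rev j), hrow, mul_one]

/-! ### Diagrams of factors -/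

/-- The diagram of a factor: two nodes are joined when the rows are not orthogonal. -/
def factorGraph (V : Matrix (Fin (n + 1)) (Fin (n + 1)) ℝ) : SimpleGraph (Fin (n + 1)) where
  Adj j k := j ≠ k ∧ V j ⬝ᵥ V k ≠ 0
  symm := ⟨fun j k h => ⟨h.1.symm, by rw [dotProduct_comm]; exact h.2⟩⟩
  loopless := ⟨fun _ h => h.1 rfl⟩

lemma factorGraph_adj {V : Matrix (Fin (n + 1)) (Fin (n + 1)) ℝ} {j k : Fin (n + 1)} :
    (factorGraph V).Adj j k ↔ j ≠ k ∧ V j ⬝ᵥ V k ≠ 0 := Iff.rfl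

lemma hCert_ne_zero_iff {H : Matrix (Fin n) (Fin n) ℝ} (hH : IsLower H) (k : Fin (n + 1))
    (j : Fin n) : hCert H k j ≠ 0 ↔ factor H j.castSucc ⬝ᵥ factor H k ≠ 0 := by
  rw [hCert_eq hH, ne_eq, neg_eq_zero, mul_eq_zero, not_or]
  exact and_iff_right (by positivity)

lemma diagram_eq {H : Matrix (Fin n) (Fin n) ℝ} (hH : IsLower H) :
    diagram H = factorGraph (factor H) := by
  ext a b
  rw [diagram, SimpleGraph.fromRel_adj, factorGraph_adj]
  refine and_congr_right fun hab => ⟨?_, fun h => ?_⟩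
  · rintro (⟨j, rfl, -, h⟩ | ⟨j, rfl, -, h⟩)
    · rw [dotProduct_comm]; exact (hCert_ne_zero_iff hH _ _).mp h
    · exact (hCert_ne_zero_iff hH _ _).mp h
  · rcases lt_or_gt_of_ne hab with hlt | hlt
    · obtain ⟨j, rfl⟩ := Fin.exists_castSucc_eq.mpr (ne_of_lt (hlt.trans_le (Fin.le_last b)))
      exact Or.inr ⟨j, rfl, hlt, (hCert_ne_zero_iff hH _ _).mpr h⟩
    · obtain ⟨j, rfl⟩ := Fin.exists_castSucc_eq.mpr (ne_of_lt (hlt.trans_le (Fin.le_last a)))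
      exact Or.inl ⟨j, rfl, hlt, (hCert_ne_zero_iff hH _ _).mpr (by rwa [dotProduct_comm])⟩

/-- A graph in which every node but the last one has exactly one larger neighbour. -/
def IsArcDiagram (G : SimpleGraph (Fin (n + 1))) : Prop :=
  ∀ j, j ≠ Fin.last n → ∃! k, j < k ∧ G.Adj j k

namespace IsNormalized

variable {V : Matrix (Fin (n + 1)) (Fin (n + 1)) ℝ}

/-- By triangularity the rows after row `j` span the coordinates after `j`. -/
lemma apply_eq_zero_of_orthogonal (hV : IsNormalized V) {w : Fin (n + 1) → ℝ} {j : Fin (n + 1)}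
    (h : ∀ k, j < k → w ⬝ᵥ V k = 0) (k : Fin (n + 1)) (hk : j < k) : w k = 0 := by
  induction k using WellFoundedGT.induction with
  | ind k ih =>
    have h1 := h k hk
    rw [dotProduct, Finset.sum_eq_single k] at h1
    · exact (mul_eq_zero.mp h1).resolve_right (hV.diag k)
    · intro i _ hi
      rcases lt_or_gt_of_ne hi with h2 | h2
      · rw [hV.upper k i h2, mul_zero]
      · rw [ih i h2 (hk.trans h2), zero_mul]
    · simp

/-- A row orthogonal to all later ones is concentrated on the diagonal, which its vanishing sum
forbids unless it is the last one. -/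
lemma exists_lt_adj (hV : IsNormalized V) {j : Fin (n + 1)} (hj : j ≠ Fin.last n) :
    ∃ k, j < k ∧ (factorGraph V).Adj j k := by
  by_contra! hcon
  have h0 := hV.apply_eq_zero_of_orthogonal (w := V j) (j := j) fun k hk => by
    by_contra hne
    exact hcon k hk ⟨hk.ne, hne⟩
  have hr := hV.row j
  rw [if_neg hj, Finset.sum_eq_single j] at hr
  · exact hV.diag j hr
  · intro k _ hk
    rcases lt_or_gt_of_ne hk with h | h
    · exact hV.upper j k h
    · exact h0 k h
  · simp

lemma row_last (hV : IsNormalized V) : V (Fin.last n) = Pi.single (Fin.last n) 1 := by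
  have h : ∀ k, k ≠ Fin.last n → V (Fin.last n) k = 0 :=
    fun k hk => hV.upper _ _ (lt_of_le_of_ne (Fin.le_last k) hk)
  ext k
  by_cases hk : k = Fin.last n
  · subst hk
    have := hV.row (Fin.last n)
    rw [Finset.sum_eq_single (Fin.last n) (fun k _ hk => h k hk) (by simp), if_pos rfl] at this
    simp [this]
  · rw [h k hk, Pi.single_eq_of_ne hk]

end IsNormalized

/-- An arc diagram determines its factor: going down from the last row, the orthogonality relations
and the row sums fix each row up to a factor, and the column sums fix these factors. -/
theorem eq_of_factorGraph_eq {V V' : Matrix (Fin (n + 1)) (Fin (n + 1)) ℝ} (hV : IsNormalized V)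
    (hV' : IsNormalized V') (hG : IsArcDiagram (factorGraph V))
    (h : factorGraph V = factorGraph V') : V = V' := by
  have hrow : ∀ j, ∃ α : ℝ, α ≠ 0 ∧ V' j = α • V j := by
    intro j
    induction j using WellFoundedGT.induction with
    | ind j ih =>
      by_cases hj : j = Fin.last n
      · exact ⟨1, one_ne_zero, by rw [hj, hV.row_last, hV'.row_last, one_smul]⟩
      obtain ⟨p, ⟨hjp, hp⟩, hpu⟩ := hG j hj
      set c := V j ⬝ᵥ V p with hc
      set c' := V' j ⬝ᵥ V p with hc'
      have hc0 : c ≠ 0 := hp.2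
      have hc0' : c' ≠ 0 := by
        obtain ⟨α, -, hαp⟩ := ih p hjp
        have := (h ▸ hp : (factorGraph V').Adj j p).2
        rw [hαp, dotProduct_smul] at this
        exact right_ne_zero_of_smul this
      refine ⟨c' / c, div_ne_zero hc0' hc0, ?_⟩
      have hw : ∀ k, j < k → (V' j - (c' / c) • V j) ⬝ᵥ V k = 0 := by
        intro k hk
        rw [sub_dotProduct, smul_dotProduct]
        by_cases hkp : k = p
        · subst hkp
          rw [← hc, ← hc', smul_eq_mul]
          field_simp
          ring
        · have h1 : V j ⬝ᵥ V k = 0 := by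
            by_contra hne
            exact hkp (hpu k ⟨hk, hk.ne, hne⟩)
          have h2 : V' j ⬝ᵥ V k = 0 := by
            obtain ⟨α, hα, hαk⟩ := ih k hk
            by_contra hne
            refine hkp (hpu k ⟨hk, h ▸ ⟨hk.ne, ?_⟩⟩)
            rw [hαk, dotProduct_smul]
            exact smul_ne_zero hα hne
          rw [h1, h2, smul_zero, sub_zero]
      have hw0 : ∀ k, k ≠ j → (V' j - (c' / c) • V j) k = 0 := by
        intro k hk
        rcases lt_or_gt_of_ne hk with h1 | h1
        · simp [hV.upper j k h1, hV'.upper j k h1]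
        · exact hV.apply_eq_zero_of_orthogonal hw k h1
      have hs : ∑ k, (V' j - (c' / c) • V j) k = 0 := by
        simp [sum_sub_distrib, ← mul_sum, hV.row, hV'.row, hj]
      rw [Finset.sum_eq_single j (fun k _ hk => hw0 k hk) (by simp)] at hs
      refine sub_eq_zero.mp (funext fun k => ?_)
      by_cases hk : k = j
      · rw [hk]; exact hs
      · exact hw0 k hk
  choose α _ hα using hrow
  have hvec : (fun j => α j - 1) ᵥ* V = 0 := by
    ext k
    have h1 := hV.col k
    have h2 := hV'.col k
    simp only [hα, Pi.smul_apply, smul_eq_mul] at h2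
    simp only [Matrix.vecMul, dotProduct, sub_mul, one_mul, sum_sub_distrib, h1, h2, sub_self,
      Pi.zero_apply]
  have hα1 : ∀ j, α j = 1 := by
    have h1 : (fun j => α j - 1) = 0 := by
      rw [← Matrix.vecMul_one (fun j => α j - 1), ← hV.mul_inv, ← Matrix.vecMul_vecMul, hvec,
        Matrix.zero_vecMul]
    exact fun j => sub_eq_zero.mp (congrFun h1 j)
  ext j k
  rw [hα j, hα1 j, one_smul]

/-! ### Gluing of factors -/

section Nodes

variable {m p : ℕ} (h : (m + 1) + (p + 1) = n + 1)

@[simp] lemma val_leftNode (i : Fin (m + 1)) : (leftNode h i : ℕ) = i := rfl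

@[simp] lemma val_rightNode (j : Fin (p + 1)) : (rightNode h j : ℕ) = m + 1 + j := rfl

lemma leftNode_injective : Function.Injective (leftNode h) :=
  fun i j hij => Fin.ext (by simpa using congrArg Fin.val hij)

lemma rightNode_injective : Function.Injective (rightNode h) :=
  fun i j hij => Fin.ext (by simpa using congrArg Fin.val hij)

lemma leftNode_lt_rightNode (i : Fin (m + 1)) (j : Fin (p + 1)) :
    leftNode h i < rightNode h j := by
  rw [Fin.lt_def, val_leftNode, val_rightNode]; omega

lemma leftNode_lt_leftNode {i j : Fin (m + 1)} : leftNode h i < leftNode h j ↔ i < j := by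
  rw [Fin.lt_def, Fin.lt_def, val_leftNode, val_leftNode]

lemma rightNode_lt_rightNode {i j : Fin (p + 1)} : rightNode h i < rightNode h j ↔ i < j := by
  rw [Fin.lt_def, Fin.lt_def, val_rightNode, val_rightNode, Nat.add_lt_add_iff_left]

lemma node_cases (a : Fin (n + 1)) : (∃ i, a = leftNode h i) ∨ ∃ j, a = rightNode h j := by
  by_cases ha : (a : ℕ) < m + 1
  · exact Or.inl ⟨⟨a, ha⟩, rfl⟩
  · exact Or.inr ⟨⟨a - (m + 1), by omega⟩, Fin.ext (by simp; omega)⟩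

lemma rightNode_last : rightNode h (Fin.last p) = Fin.last n := Fin.ext (by simp; omega)

lemma rightNode_eq_last {j : Fin (p + 1)} : rightNode h j = Fin.last n ↔ j = Fin.last p := by
  rw [← rightNode_last h, (rightNode_injective h).eq_iff]

lemma leftNode_ne_last (i : Fin (m + 1)) : leftNode h i ≠ Fin.last n := by
  rw [← rightNode_last h]; exact (leftNode_lt_rightNode h _ _).ne

lemma sum_nodes {M : Type*} [AddCommMonoid M] (f : Fin (n + 1) → M) :
    ∑ k, f k = ∑ i, f (leftNode h i) + ∑ j, f (rightNode h j) := by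
  rw [← Equiv.sum_comp (finCongr h) f, Fin.sum_univ_add]
  rfl

lemma rev_leftNode (h' : (p + 1) + (m + 1) = n + 1) (i : Fin (m + 1)) :
    (leftNode h i).rev = rightNode h' i.rev := Fin.ext (by simp [Fin.val_rev]; omega)

lemma rev_rightNode (h' : (p + 1) + (m + 1) = n + 1) (j : Fin (p + 1)) :
    (rightNode h j).rev = leftNode h' j.rev := Fin.ext (by simp [Fin.val_rev]; omega)

/-- The factor obtained by gluing: a block upper triangular matrix, whose off-diagonal block is
constant on its last row and zero elsewhere. -/
def glueFactor (V₁ : Matrix (Fin (m + 1)) (Fin (m + 1)) ℝ)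
    (V₂ : Matrix (Fin (p + 1)) (Fin (p + 1)) ℝ) : Matrix (Fin (n + 1)) (Fin (n + 1)) ℝ :=
  Matrix.of fun a b => Matrix.fromBlocks ((((m : ℝ) + 1) / (n + 1)) • V₁)
    (Matrix.of fun i _ => if i = Fin.last m then -(((m : ℝ) + 1) / ((n + 1) * (p + 1))) else 0)
    0 V₂ (finSumFinEquiv.symm (Fin.cast h.symm a)) (finSumFinEquiv.symm (Fin.cast h.symm b))

variable {V₁ V₁' : Matrix (Fin (m + 1)) (Fin (m + 1)) ℝ}
  {V₂ V₂' : Matrix (Fin (p + 1)) (Fin (p + 1)) ℝ}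

lemma glueFactor_left_left (i i' : Fin (m + 1)) :
    glueFactor h V₁ V₂ (leftNode h i) (leftNode h i') = ((m : ℝ) + 1) / (n + 1) * V₁ i i' := by
  simp [glueFactor, leftNode]

lemma glueFactor_left_right (i : Fin (m + 1)) (j : Fin (p + 1)) :
    glueFactor h V₁ V₂ (leftNode h i) (rightNode h j)
      = if i = Fin.last m then -(((m : ℝ) + 1) / ((n + 1) * (p + 1))) else 0 := by
  simp [glueFactor, leftNode, rightNode]

lemma glueFactor_right_left (i : Fin (m + 1)) (j : Fin (p + 1)) :
    glueFactor h V₁ V₂ (rightNode h j) (leftNode h i) = 0 := by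
  simp [glueFactor, leftNode, rightNode]

lemma glueFactor_right_right (j j' : Fin (p + 1)) :
    glueFactor h V₁ V₂ (rightNode h j) (rightNode h j') = V₂ j j' := by
  simp [glueFactor, rightNode]

lemma glueFactor_injective (hg : glueFactor h V₁ V₂ = glueFactor h V₁' V₂') :
    V₁ = V₁' ∧ V₂ = V₂' := by
  constructor
  · ext i i'
    have := congrFun (congrFun hg (leftNode h i)) (leftNode h i')
    rw [glueFactor_left_left, glueFactor_left_left] at this
    exact mul_left_cancel₀ (by positivity) this
  · ext j j'
    have := congrFun (congrFun hg (rightNode h j)) (rightNode h j')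
    rwa [glueFactor_right_right, glueFactor_right_right] at this

lemma glueFactor_dotProduct_left_left (i i' : Fin (m + 1)) (hi : i ≠ i') :
    glueFactor h V₁ V₂ (leftNode h i) ⬝ᵥ glueFactor h V₁ V₂ (leftNode h i')
      = (((m : ℝ) + 1) / (n + 1)) ^ 2 * (V₁ i ⬝ᵥ V₁ i') := by
  have : ∀ j : Fin (p + 1), glueFactor h V₁ V₂ (leftNode h i) (rightNode h j)
      * glueFactor h V₁ V₂ (leftNode h i') (rightNode h j) = 0 := by
    intro j
    rw [glueFactor_left_right, glueFactor_left_right]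
    split_ifs with h1 h2
    · exact absurd (h1.trans h2.symm) hi
    all_goals simp
  simp only [dotProduct, sum_nodes h, this, glueFactor_left_left, sum_const_zero, add_zero, mul_sum]
  exact sum_congr rfl fun k _ => by ring

lemma glueFactor_dotProduct_left_right (hV₂ : IsNormalized V₂) (i : Fin (m + 1))
    (j : Fin (p + 1)) :
    glueFactor h V₁ V₂ (leftNode h i) ⬝ᵥ glueFactor h V₁ V₂ (rightNode h j)
      = if i = Fin.last m ∧ j = Fin.last p then -(((m : ℝ) + 1) / ((n + 1) * (p + 1))) else 0 := by
  simp only [dotProduct, sum_nodes h, glueFactor_right_left, mul_zero, sum_const_zero, zero_add,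
    glueFactor_left_right, glueFactor_right_right, ← mul_sum, hV₂.row]
  by_cases h1 : i = Fin.last m <;> by_cases h2 : j = Fin.last p <;> simp [h1, h2]

lemma glueFactor_dotProduct_right_right (j j' : Fin (p + 1)) :
    glueFactor h V₁ V₂ (rightNode h j) ⬝ᵥ glueFactor h V₁ V₂ (rightNode h j')
      = V₂ j ⬝ᵥ V₂ j' := by
  simp only [dotProduct, sum_nodes h, glueFactor_right_left, mul_zero, sum_const_zero, zero_add,
    glueFactor_right_right]

include h in
lemma cast_size : (m : ℝ) + 1 + (p + 1) = n + 1 := by exact_mod_cast h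

lemma isOptimalFactor_glueFactor (hV₁ : IsOptimalFactor V₁) (hV₂ : IsOptimalFactor V₂) :
    IsOptimalFactor (glueFactor h V₁ V₂) where
  upper a b hab := by
    rcases node_cases h a with ⟨i, rfl⟩ | ⟨i, rfl⟩ <;>
      rcases node_cases h b with ⟨j, rfl⟩ | ⟨j, rfl⟩
    · rw [glueFactor_left_left, hV₁.upper i j ((leftNode_lt_leftNode h).mp hab), mul_zero]
    · exact absurd hab (leftNode_lt_rightNode h i j).asymm
    · rw [glueFactor_right_left]
    · rw [glueFactor_right_right, hV₂.upper i j ((rightNode_lt_rightNode h).mp hab)]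
  diag a := by
    rcases node_cases h a with ⟨i, rfl⟩ | ⟨i, rfl⟩
    · rw [glueFactor_left_left]
      exact mul_ne_zero (by positivity) (hV₁.diag i)
    · rw [glueFactor_right_right]
      exact hV₂.diag i
  row a := by
    rw [sum_nodes h]
    rcases node_cases h a with ⟨i, rfl⟩ | ⟨i, rfl⟩
    · simp only [glueFactor_left_left, glueFactor_left_right, ← mul_sum, hV₁.row, sum_const,
        card_univ, Fintype.card_fin, nsmul_eq_mul, if_neg (leftNode_ne_last h i)]
      split_ifs
      · push_cast; field_simp; ring
      · simp
    · simp only [glueFactor_right_left, glueFactor_right_right, hV₂.row, sum_const_zero, zero_add,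
        rightNode_eq_last h]
  col b := by
    rw [sum_nodes h]
    have hs := cast_size h
    rcases node_cases h b with ⟨i, rfl⟩ | ⟨i, rfl⟩
    · simp only [glueFactor_left_left, glueFactor_right_left, ← mul_sum, hV₁.col, sum_const_zero]
      field_simp; ring
    · simp only [glueFactor_left_right, glueFactor_right_right, hV₂.col, sum_ite_eq', mem_univ,
        if_true]
      field_simp; linarith
  obtuse a b hab := by
    rcases node_cases h a with ⟨i, rfl⟩ | ⟨i, rfl⟩ <;>
      rcases node_cases h b with ⟨j, rfl⟩ | ⟨j, rfl⟩
    · have hij : i ≠ j := fun e => hab (e ▸ rfl)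
      rw [glueFactor_dotProduct_left_left h i j hij]
      exact mul_nonpos_of_nonneg_of_nonpos (by positivity) (hV₁.obtuse i j hij)
    · rw [glueFactor_dotProduct_left_right h hV₂.toIsNormalized]
      split_ifs
      · rw [neg_nonpos]; positivity
      · exact le_rfl
    · rw [dotProduct_comm, glueFactor_dotProduct_left_right h hV₂.toIsNormalized]
      split_ifs
      · rw [neg_nonpos]; positivity
      · exact le_rfl
    · rw [glueFactor_dotProduct_right_right]
      exact hV₂.obtuse i j fun e => hab (e ▸ rfl)

lemma glue_adj_left_left {G₁ : SimpleGraph (Fin (m + 1))} {G₂ : SimpleGraph (Fin (p + 1))}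
    (i i' : Fin (m + 1)) : (glue h G₁ G₂).Adj (leftNode h i) (leftNode h i') ↔ G₁.Adj i i' := by
  have hlr := fun i j => (leftNode_lt_rightNode h i j).ne
  simp only [glue, SimpleGraph.fromRel_adj, ne_eq, (leftNode_injective h).eq_iff, hlr,
    and_false, exists_false, or_false]
  constructor
  · rintro ⟨-, ⟨a, b, hab, rfl, rfl⟩ | ⟨a, b, hab, rfl, rfl⟩⟩
    exacts [hab, hab.symm]
  · exact fun hab => ⟨hab.ne, Or.inl ⟨i, i', hab, rfl, rfl⟩⟩

lemma glue_adj_right_right {G₁ : SimpleGraph (Fin (m + 1))} {G₂ : SimpleGraph (Fin (p + 1))}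
    (i i' : Fin (p + 1)) : (glue h G₁ G₂).Adj (rightNode h i) (rightNode h i') ↔ G₂.Adj i i' := by
  have hlr := fun i j => (leftNode_lt_rightNode h i j).ne'
  simp only [glue, SimpleGraph.fromRel_adj, ne_eq, (rightNode_injective h).eq_iff, hlr, false_and,
    and_false, exists_false, or_false, false_or]
  constructor
  · rintro ⟨-, ⟨a, b, hab, rfl, rfl⟩ | ⟨a, b, hab, rfl, rfl⟩⟩
    exacts [hab, hab.symm]
  · exact fun hab => ⟨hab.ne, Or.inl ⟨i, i', hab, rfl, rfl⟩⟩

lemma glue_adj_left_right {G₁ : SimpleGraph (Fin (m + 1))} {G₂ : SimpleGraph (Fin (p + 1))}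
    (i : Fin (m + 1)) (j : Fin (p + 1)) :
    (glue h G₁ G₂).Adj (leftNode h i) (rightNode h j) ↔ i = Fin.last m ∧ j = Fin.last p := by
  have hlr := fun i j => (leftNode_lt_rightNode h i j).ne
  have hrl := fun i j => (leftNode_lt_rightNode h i j).ne'
  simp only [glue, SimpleGraph.fromRel_adj, ne_eq, (leftNode_injective h).eq_iff,
    (rightNode_injective h).eq_iff, hlr, hrl, false_and, and_false, exists_false, or_false,
    false_or, not_false_iff, true_and]

lemma glue_ext {G : SimpleGraph (Fin (n + 1))} {G₁ : SimpleGraph (Fin (m + 1))}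
    {G₂ : SimpleGraph (Fin (p + 1))}
    (hl : ∀ i i', G.Adj (leftNode h i) (leftNode h i') ↔ G₁.Adj i i')
    (hr : ∀ j j', G.Adj (rightNode h j) (rightNode h j') ↔ G₂.Adj j j')
    (hlr : ∀ i j, G.Adj (leftNode h i) (rightNode h j) ↔ i = Fin.last m ∧ j = Fin.last p) :
    G = glue h G₁ G₂ := by
  ext a b
  rcases node_cases h a with ⟨i, rfl⟩ | ⟨i, rfl⟩ <;>
    rcases node_cases h b with ⟨j, rfl⟩ | ⟨j, rfl⟩
  · rw [hl, glue_adj_left_left]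
  · rw [hlr, glue_adj_left_right]
  · rw [SimpleGraph.adj_comm, hlr, SimpleGraph.adj_comm, glue_adj_left_right]
  · rw [hr, glue_adj_right_right]

lemma comap_leftNode_glue (G₁ : SimpleGraph (Fin (m + 1))) (G₂ : SimpleGraph (Fin (p + 1))) :
    (glue h G₁ G₂).comap (leftNode h) = G₁ := by
  ext i i'
  exact glue_adj_left_left h i i'

lemma comap_rightNode_glue (G₁ : SimpleGraph (Fin (m + 1))) (G₂ : SimpleGraph (Fin (p + 1))) :
    (glue h G₁ G₂).comap (rightNode h) = G₂ := by
  ext i i'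
  exact glue_adj_right_right h i i'

lemma decomposableAt_iff {G : SimpleGraph (Fin (n + 1))} :
    DecomposableAt G (leftNode h (Fin.last m)) ↔
      G = glue h (G.comap (leftNode h)) (G.comap (rightNode h)) := by
  constructor
  · rintro ⟨-, h2, h3⟩
    refine glue_ext h (fun _ _ => Iff.rfl) (fun _ _ => Iff.rfl) fun i j => ?_
    by_cases hi : i = Fin.last m
    · subst hi
      rw [h2 _ (leftNode_lt_rightNode h _ _), ← rightNode_last h, (rightNode_injective h).eq_iff]
      simp
    · simp only [hi, false_and, iff_false]
      intro hadj
      refine absurd (h3 _ _ ?_ (leftNode_lt_rightNode h i j) hadj)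
        (not_le.mpr (leftNode_lt_rightNode h _ _))
      rw [Fin.lt_def, val_leftNode, val_leftNode]
      exact Fin.val_lt_last hi
  · intro hG
    rw [hG]
    refine ⟨?_, ?_, ?_⟩
    · rw [← rightNode_last h]; exact leftNode_lt_rightNode h _ _
    · intro k hk
      rcases node_cases h k with ⟨i, rfl⟩ | ⟨i, rfl⟩
      · exact absurd hk (by rw [Fin.lt_def, val_leftNode, val_leftNode, Fin.val_last]; omega)
      · rw [glue_adj_left_right, ← rightNode_last h, (rightNode_injective h).eq_iff]
        simp
    · intro j k hj hjk hadj
      rcases node_cases h k with ⟨i, rfl⟩ | ⟨i, rfl⟩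
      · rw [Fin.le_def, val_leftNode, val_leftNode, Fin.val_last]; omega
      · rcases node_cases h j with ⟨j, rfl⟩ | ⟨j, rfl⟩
        · rw [glue_adj_left_right] at hadj
          rw [hadj.1] at hj
          exact absurd hj (lt_irrefl _)
        · exact absurd (hj.trans (leftNode_lt_rightNode h (Fin.last m) j)) (lt_irrefl _)

lemma factorGraph_glueFactor (hV₂ : IsNormalized V₂) :
    factorGraph (glueFactor h V₁ V₂) = glue h (factorGraph V₁) (factorGraph V₂) := by
  refine glue_ext h (fun i i' => ?_) (fun j j' => ?_) fun i j => ?_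
  · rw [factorGraph_adj, factorGraph_adj, ne_eq, (leftNode_injective h).eq_iff]
    refine and_congr_right fun hi => ?_
    rw [glueFactor_dotProduct_left_left h i i' hi, ne_eq, mul_eq_zero, not_or]
    exact and_iff_right (by positivity)
  · rw [factorGraph_adj, factorGraph_adj, ne_eq, (rightNode_injective h).eq_iff,
      glueFactor_dotProduct_right_right]
  · rw [factorGraph_adj, glueFactor_dotProduct_left_right h hV₂, and_iff_right
      (leftNode_lt_rightNode h i j).ne, ne_eq, ite_eq_right_iff, Classical.not_imp]
    refine and_iff_left ?_
    rw [neg_eq_zero]; positivity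

/-- Gluing reverses the order of its two arguments under duality. -/
lemma isDualFactor_glueFactor (h' : (p + 1) + (m + 1) = n + 1) (hV₁ : IsNormalized V₁)
    (hV₂' : IsNormalized V₂') (hd₁ : IsDualFactor V₁ V₁') (hd₂ : IsDualFactor V₂ V₂') :
    IsDualFactor (glueFactor h V₁ V₂) (glueFactor h' V₂' V₁') := by
  have hs := cast_size h
  have e₁ : ∀ i i', ∑ x, V₁ i x * V₁' i'.rev x.rev
      = 1 / ((m : ℝ) + 1) * difference (m + 1) i i' := fun i i' =>
    congrFun (congrFun hd₁ i) i'
  have e₂ : ∀ i i', ∑ x, V₂ i x * V₂' i'.rev x.rev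
      = 1 / ((p : ℝ) + 1) * difference (p + 1) i i' := fun i i' =>
    congrFun (congrFun hd₂ i) i'
  ext a b
  rw [Matrix.mul_apply, sum_nodes h]
  simp only [hDual_apply, Matrix.smul_apply, smul_eq_mul, rev_leftNode h h', rev_rightNode h h']
  rcases node_cases h a with ⟨i, rfl⟩ | ⟨i, rfl⟩ <;>
    rcases node_cases h b with ⟨j, rfl⟩ | ⟨j, rfl⟩
  · simp only [rev_leftNode h h', glueFactor_left_left, glueFactor_right_right,
      glueFactor_right_left, mul_zero, sum_const_zero, add_zero, mul_assoc, ← mul_sum, e₁]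
    have : difference (n + 1) (leftNode h i) (leftNode h j) = difference (m + 1) i j := by
      simp only [difference, Matrix.of_apply, (leftNode_injective h).eq_iff, val_leftNode]
      exact if_congr Iff.rfl rfl (if_congr Iff.rfl rfl rfl)
    rw [this]
    field_simp
  · have hj : j.rev = Fin.last p ↔ j = 0 := by rw [Fin.rev_eq_iff, Fin.rev_last]
    simp only [rev_rightNode h h', glueFactor_left_left, glueFactor_left_right, mul_assoc,
      ← mul_sum, ← sum_mul, hV₁.row, sum_rev (fun x => V₂' j.rev x), hV₂'.row, hj]
    have : difference (n + 1) (leftNode h i) (rightNode h j)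
        = if i = Fin.last m ∧ j = 0 then -1 else 0 := by
      simp only [difference, Matrix.of_apply, (leftNode_lt_rightNode h i j).ne, if_false,
        val_leftNode, val_rightNode]
      refine if_congr ?_ rfl rfl
      rw [Fin.ext_iff, Fin.ext_iff, Fin.val_last, Fin.val_zero]
      omega
    rw [this]
    by_cases h1 : i = Fin.last m <;> by_cases h2 : j = 0 <;> simp only [h1, h2, if_true, if_false,
      and_self, and_true, and_false, mul_zero, zero_mul, add_zero, mul_one]
    field_simp
    linarith
  · have : difference (n + 1) (rightNode h i) (leftNode h j) = 0 := by
      simp only [difference, Matrix.of_apply, (leftNode_lt_rightNode h j i).ne', if_false]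
      exact if_neg (by rw [val_leftNode, val_rightNode]; omega)
    rw [this]
    simp [rev_leftNode h h', glueFactor_right_left]
  · simp only [rev_rightNode h h', glueFactor_left_left, glueFactor_right_right,
      glueFactor_right_left, zero_mul, sum_const_zero, zero_add, mul_left_comm (V₂ _ _),
      ← mul_sum, e₂]
    have : difference (n + 1) (rightNode h i) (rightNode h j) = difference (p + 1) i j := by
      simp only [difference, Matrix.of_apply, (rightNode_injective h).eq_iff, val_rightNode]
      refine if_congr Iff.rfl rfl (if_congr (by omega) rfl rfl)
    rw [this]
    field_simp

/-- A factor with decomposable diagram is glued: orthogonality makes the off-diagonal block vanish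
except in its last row, which is constant. -/
theorem exists_eq_glueFactor {V : Matrix (Fin (n + 1)) (Fin (n + 1)) ℝ} (hV : IsOptimalFactor V)
    {G₁ : SimpleGraph (Fin (m + 1))} {G₂ : SimpleGraph (Fin (p + 1))}
    (hG : factorGraph V = glue h G₁ G₂) :
    ∃ V₁ V₂, IsOptimalFactor V₁ ∧ IsOptimalFactor V₂ ∧ V = glueFactor h V₁ V₂ := by
  have hs := cast_size h
  set v := leftNode h (Fin.last m) with hv
  set κ := V v (Fin.last n) with hκ
  have horth : ∀ i j, ¬(i = Fin.last m ∧ j = Fin.last p) →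
      V (leftNode h i) ⬝ᵥ V (rightNode h j) = 0 := by
    intro i j hij
    by_contra hne
    have : (factorGraph V).Adj (leftNode h i) (rightNode h j) :=
      ⟨(leftNode_lt_rightNode h i j).ne, hne⟩
    rw [hG, glue_adj_left_right] at this
    exact hij this
  have hright : ∀ k, v < k → ∃ j, k = rightNode h j := by
    intro k hk
    rcases node_cases h k with ⟨i, rfl⟩ | hj
    · exact absurd hk (by rw [hv, Fin.lt_def, val_leftNode, val_leftNode, Fin.val_last]; omega)
    · exact hj
  have hlr : ∀ i j, V (leftNode h i) (rightNode h j) = if i = Fin.last m then κ else 0 := by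
    intro i j
    split_ifs with hi
    · subst hi
      have := hV.toIsNormalized.apply_eq_zero_of_orthogonal (w := fun k => V v k - κ) (j := v)
        (fun k hk => by
          by_cases hkn : k = Fin.last n
          · rw [hkn, hV.toIsNormalized.row_last]
            simp [hκ]
          · obtain ⟨j, rfl⟩ := hright k hk
            have h1 := horth (Fin.last m) j (fun hj => hkn (by rw [hj.2, rightNode_last]))
            have h2 := hV.row (rightNode h j)
            rw [if_neg hkn] at h2
            simp only [dotProduct] at h1 ⊢
            simp only [sub_mul, sum_sub_distrib, ← mul_sum, h2, mul_zero, sub_zero]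
            exact h1) (rightNode h j) (leftNode_lt_rightNode h _ _)
      linarith
    · exact hV.toIsNormalized.apply_eq_zero_of_orthogonal (w := V (leftNode h i)) (j := v)
        (fun k hk => by
          obtain ⟨j, rfl⟩ := hright k hk
          exact horth i j fun hj => hi hj.1) (rightNode h j) (leftNode_lt_rightNode h _ _)
  have hrl : ∀ i j, V (rightNode h j) (leftNode h i) = 0 :=
    fun i j => hV.upper _ _ (leftNode_lt_rightNode h i j)
  have hrow₂ : ∀ j, ∑ k, V (rightNode h j) (rightNode h k) = if j = Fin.last p then 1 else 0 := by
    intro j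
    have := hV.row (rightNode h j)
    rw [sum_nodes h] at this
    simp only [hrl, sum_const_zero, zero_add, rightNode_eq_last h] at this
    exact this
  have hcol₂ : ∀ k, ∑ j, V (rightNode h j) (rightNode h k) = 1 / ((n : ℝ) + 1) - κ := by
    intro k
    have := hV.col (rightNode h k)
    rw [sum_nodes h] at this
    simp only [hlr, sum_ite_eq', mem_univ, if_true] at this
    linarith
  have hκval : κ = -(((m : ℝ) + 1) / ((n + 1) * (p + 1))) := by
    have h1 : ∑ k, ∑ j, V (rightNode h j) (rightNode h k) = 1 := by
      rw [sum_comm]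
      simp [hrow₂]
    simp only [hcol₂, sum_const, card_univ, Fintype.card_fin, nsmul_eq_mul] at h1
    push_cast at h1
    have h2 : κ = 1 / ((n : ℝ) + 1) - 1 / (p + 1) := by
      field_simp at h1 ⊢
      linarith
    rw [h2, ← hs]
    field_simp
    ring
  set V₂ : Matrix (Fin (p + 1)) (Fin (p + 1)) ℝ :=
    Matrix.of fun j k => V (rightNode h j) (rightNode h k) with hV₂
  set V₁ : Matrix (Fin (m + 1)) (Fin (m + 1)) ℝ :=
    Matrix.of fun j k => ((n : ℝ) + 1) / (m + 1) * V (leftNode h j) (leftNode h k) with hV₁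
  have hglue : V = glueFactor h V₁ V₂ := by
    ext a b
    rcases node_cases h a with ⟨i, rfl⟩ | ⟨i, rfl⟩ <;>
      rcases node_cases h b with ⟨j, rfl⟩ | ⟨j, rfl⟩
    · rw [glueFactor_left_left]
      simp only [hV₁, Matrix.of_apply]
      field_simp
    · rw [glueFactor_left_right, hlr, hκval]
    · rw [glueFactor_right_left, hrl]
    · rw [glueFactor_right_right]; rfl
  refine ⟨V₁, V₂, ?_, ?_, hglue⟩
  · constructor
    · constructor
      · intro j k hjk
        simp only [hV₁, Matrix.of_apply]
        rw [hV.upper _ _ ((leftNode_lt_leftNode h).mpr hjk), mul_zero]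
      · intro j
        simp only [hV₁, Matrix.of_apply]
        exact mul_ne_zero (by positivity) (hV.diag _)
      · intro j
        have h1 := hV.row (leftNode h j)
        rw [sum_nodes h, if_neg (leftNode_ne_last h j)] at h1
        simp only [hlr, sum_const, card_univ, Fintype.card_fin, nsmul_eq_mul, hκval] at h1
        simp only [hV₁, Matrix.of_apply, ← mul_sum, eq_neg_of_add_eq_zero_left h1]
        split_ifs
        · push_cast; field_simp
        · simp
      · intro k
        have h1 := hV.col (leftNode h k)
        rw [sum_nodes h] at h1
        simp only [hrl, sum_const_zero, add_zero] at h1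
        simp only [hV₁, Matrix.of_apply, ← mul_sum, h1]
        field_simp
    · intro j k hjk
      have h1 := hV.obtuse (leftNode h j) (leftNode h k) ((leftNode_injective h).ne hjk)
      rw [hglue, glueFactor_dotProduct_left_left h j k hjk] at h1
      exact nonpos_of_mul_nonpos_right h1 (by positivity)
  · constructor
    · constructor
      · intro j k hjk
        exact hV.upper _ _ ((rightNode_lt_rightNode h).mpr hjk)
      · exact fun j => hV.diag _
      · exact hrow₂
      · intro k
        simp only [hV₂, Matrix.of_apply, hcol₂, hκval]
        rw [← hs]
        field_simp
        ring
    · intro j k hjk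
      have h1 := hV.obtuse (rightNode h j) (rightNode h k) ((rightNode_injective h).ne hjk)
      rwa [hglue, glueFactor_dotProduct_right_right] at h1

end Nodes

/-! ### Arc diagrams with an optimal dual do not cross -/

/-- No two arcs of the graph cross. -/
def IsNoncrossing (G : SimpleGraph (Fin (n + 1))) : Prop :=
  ∀ a b c d, a < b → b < c → c < d → G.Adj a c → G.Adj b d → False

/-- The inverse of the Gram matrix of the rows of `V`.  When the diagram is a tree this is the Green
function of the tree with conductances `-⟨V_j, V_k⟩`: its row `a` drops along the path from `a` to the
last node and is constant on the branches off this path. -/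
def green (V : Matrix (Fin (n + 1)) (Fin (n + 1)) ℝ) : Matrix (Fin (n + 1)) (Fin (n + 1)) ℝ :=
  (V⁻¹)ᵀ * V⁻¹

section Green

variable {V V' : Matrix (Fin (n + 1)) (Fin (n + 1)) ℝ}

lemma sum_dotProduct_mul_green (hV : IsNormalized V) (a k : Fin (n + 1)) :
    ∑ l, V k ⬝ᵥ V l * green V a l = if k = a then 1 else 0 := by
  have h1 : V * Vᵀ * green V = 1 := by
    have h2 : Vᵀ * (V⁻¹)ᵀ = 1 := by rw [← Matrix.transpose_mul, hV.inv_mul, Matrix.transpose_one]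
    rw [green, mul_assoc, ← mul_assoc Vᵀ, h2, one_mul, hV.mul_inv]
  have hsymm : ∀ l, green V l a = green V a l := by
    intro l
    simp only [green, Matrix.mul_apply, Matrix.transpose_apply]
    exact sum_congr rfl fun i _ => mul_comm _ _
  have h3 := congrFun (congrFun h1 k) a
  rw [Matrix.mul_apply, Matrix.one_apply] at h3
  rw [← h3]
  refine sum_congr rfl fun l _ => ?_
  rw [hsymm]
  rfl

/-- Optimality of the dual makes each row of the Green function nonincreasing from the diagonal on. -/
lemma green_antitone (hV : IsNormalized V) (hV' : IsOptimalFactor V') (hd : IsDualFactor V V')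
    {a k l : Fin (n + 1)} (hak : a ≤ k) (hkl : k ≤ l) : green V a l ≤ green V a k := by
  set X := V⁻¹ * difference (n + 1) with hX
  have hdual : hDual V' = (1 / ((n : ℝ) + 1)) • X := by
    have : V⁻¹ * (V * hDual V') = V⁻¹ * ((1 / ((n : ℝ) + 1)) • difference (n + 1)) :=
      congrArg (V⁻¹ * ·) hd
    rwa [← mul_assoc, hV.inv_mul, one_mul, Matrix.mul_smul] at this
  have hXX : ∀ b c, b ≠ c → ∑ i, X i b * X i c ≤ 0 := by
    intro b c hbc
    have h1 := hV'.obtuse b.rev c.rev fun h => hbc (Fin.rev_inj.mp h)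
    have h2 : ∀ i b, V' b.rev i.rev = 1 / ((n : ℝ) + 1) * X i b := fun i b =>
      congrFun (congrFun hdual i) b
    rw [dotProduct, ← sum_rev (fun i => V' b.rev i * V' c.rev i)] at h1
    simp only [h2] at h1
    have h3 : ∑ i, 1 / ((n : ℝ) + 1) * X i b * (1 / ((n : ℝ) + 1) * X i c)
        = (1 / ((n : ℝ) + 1)) ^ 2 * ∑ i, X i b * X i c := by
      rw [mul_sum]
      exact sum_congr rfl fun i _ => by ring
    rw [h3] at h1
    exact nonpos_of_mul_nonpos_right h1 (by positivity)
  have hstep : ∀ (k : Fin n) (a : Fin (n + 1)), a < k.succ →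
      ∑ i, V⁻¹ i a * X i k.succ ≤ 0 := by
    intro k a
    induction a using Fin.induction with
    | zero =>
      intro h
      have := hXX 0 k.succ h.ne
      simpa only [hX, mul_difference_zero] using this
    | succ a ih =>
      intro h
      have h1 := hXX a.succ k.succ h.ne
      have h2 := ih ((Fin.castSucc_lt_succ (i := a)).trans h)
      have h3 : ∀ i, V⁻¹ i a.succ * X i k.succ
          = V⁻¹ i a.castSucc * X i k.succ + X i a.succ * X i k.succ := by
        intro i
        have : X i a.succ = V⁻¹ i a.succ - V⁻¹ i a.castSucc := mul_difference_succ _ i a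
        rw [this]; ring
      simp only [h3, sum_add_distrib]
      linarith
  have hstep' : ∀ k : Fin n, a < k.succ → green V a k.succ ≤ green V a k.castSucc := by
    intro k hk
    have := hstep k a hk
    have h3 : ∀ i, V⁻¹ i a * X i k.succ
        = V⁻¹ i a * V⁻¹ i k.succ - V⁻¹ i a * V⁻¹ i k.castSucc := by
      intro i
      have : X i k.succ = V⁻¹ i k.succ - V⁻¹ i k.castSucc := mul_difference_succ _ i k
      rw [this]; ring
    simp only [h3, sum_sub_distrib] at this
    simp only [green, Matrix.mul_apply, Matrix.transpose_apply]
    linarith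
  induction l using Fin.induction with
  | zero => rw [le_antisymm hkl (Fin.zero_le _)]
  | succ l ih =>
    rcases eq_or_lt_of_le hkl with rfl | h
    · exact le_rfl
    · exact (hstep' l (hak.trans_lt h)).trans (ih (Fin.le_castSucc_iff.mpr h))

/-- If two arcs `a → c` and `b → d` of the diagram cross, `a < b < c < d`, then in row `a` of the
Green function the values at `b` and `d` agree, so by monotonicity the value at `c` is the same; as
the value at the larger neighbour of `c` is smaller, that neighbour lies beyond `d`, and the arcs from
`b` and `c` cross in turn.  This cannot go on forever. -/
theorem isNoncrossing_of_isDualFactor (hV : IsOptimalFactor V) (hV' : IsOptimalFactor V')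
    (hd : IsDualFactor V V') (hG : IsArcDiagram (factorGraph V)) :
    IsNoncrossing (factorGraph V) := by
  have hpar : ∀ j, ∃ k, j ≠ Fin.last n → (j < k ∧ (factorGraph V).Adj j k) ∧
      ∀ l, j < l → (factorGraph V).Adj j l → l = k := by
    intro j
    by_cases hj : j = Fin.last n
    · exact ⟨j, fun h => absurd hj h⟩
    · obtain ⟨k, hk, hu⟩ := hG j hj
      exact ⟨k, fun _ => ⟨hk, fun l h1 h2 => hu l ⟨h1, h2⟩⟩⟩
  choose p hp using hpar
  have hne : ∀ {j k : Fin (n + 1)}, j < k → j ≠ Fin.last n := fun h =>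
    (h.trans_le (Fin.le_last _)).ne
  have hneg : ∀ j, j ≠ Fin.last n → V j ⬝ᵥ V (p j) < 0 := fun j hj =>
    lt_of_le_of_ne (hV.obtuse _ _ (hp j hj).1.1.ne) (hp j hj).1.2.2
  -- Kirchhoff's law at the node `k` for the potential `green V a`
  have hkir : ∀ a k, k ≠ Fin.last n → V k ⬝ᵥ V (p k) * (green V a (p k) - green V a k)
      + ∑ l ∈ univ.filter (fun l => l < k), V k ⬝ᵥ V l * (green V a l - green V a k)
      = if k = a then 1 else 0 := by
    intro a k hk
    rw [← sum_dotProduct_mul_green hV.toIsNormalized a k]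
    have h1 : ∑ l, V k ⬝ᵥ V l * green V a l
        = ∑ l, V k ⬝ᵥ V l * (green V a l - green V a k) := by
      simp only [mul_sub, sum_sub_distrib, ← sum_mul, hV.toIsNormalized.sum_row_dotProduct, if_neg hk,
        zero_mul, sub_zero]
    rw [h1, ← sum_filter_add_sum_filter_not univ (fun l => l < k), add_comm]
    congr 1
    symm
    apply Finset.sum_eq_single (p k)
    · intro l hl hlp
      simp only [mem_filter, mem_univ, true_and, not_lt] at hl
      rcases eq_or_lt_of_le hl with rfl | hlt
      · rw [sub_self, mul_zero]
      · by_cases h0 : V k ⬝ᵥ V l = 0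
        · rw [h0, zero_mul]
        · exact absurd ((hp k hk).2 l hlt ⟨hlt.ne, h0⟩) hlp
    · intro h
      simp only [mem_filter, mem_univ, true_and, not_not] at h
      exact absurd (hp k hk).1.1 h.asymm
  have hparent : ∀ {l k}, l < k → V k ⬝ᵥ V l ≠ 0 → p l = k := fun {l k} hl h0 =>
    ((hp l (hne hl)).2 k hl ⟨hl.ne, by rwa [dotProduct_comm]⟩).symm
  -- the potential is constant along the arcs that no flow from `a` passes
  have hconst : ∀ a k, a ≠ Fin.last n → k ≠ a → k < p a →
      green V a k = green V a (p k) := by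
    intro a k ha
    induction k using WellFoundedLT.induction with
    | ind k ih =>
      intro hka hkp
      have hk := hne hkp
      have h1 := hkir a k hk
      rw [if_neg hka, sum_eq_zero, add_zero] at h1
      · have := (mul_eq_zero.mp h1).resolve_left (hneg k hk).ne
        linarith
      · intro l hl
        simp only [mem_filter, mem_univ, true_and] at hl
        by_cases h0 : V k ⬝ᵥ V l = 0
        · rw [h0, zero_mul]
        · have hpl := hparent hl h0
          have hla : l ≠ a := by rintro rfl; exact hkp.ne hpl.symm
          rw [ih l hl hla (hl.trans hkp), hpl, sub_self, mul_zero]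
  have hflow : ∀ a, a ≠ Fin.last n →
      V a ⬝ᵥ V (p a) * (green V a (p a) - green V a a) = 1 := by
    intro a ha
    have h1 := hkir a a ha
    rw [if_pos rfl, sum_eq_zero, add_zero] at h1
    · exact h1
    · intro l hl
      simp only [mem_filter, mem_univ, true_and] at hl
      by_cases h0 : V a ⬝ᵥ V l = 0
      · rw [h0, zero_mul]
      · rw [hconst a l ha hl.ne (hl.trans (hp a ha).1.1), hparent hl h0, sub_self, mul_zero]
  have hdrop : ∀ a, a ≠ Fin.last n → p a ≠ Fin.last n →
      green V a (p (p a)) < green V a (p a) := by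
    intro a ha hpa
    have hap := (hp a ha).1.1
    have h1 := hkir a (p a) hpa
    rw [if_neg hap.ne', Finset.sum_eq_single a] at h1
    · have h2 := hflow a ha
      rw [dotProduct_comm (V (p a)) (V a)] at h1
      have h3 := hneg (p a) hpa
      have h4 : V (p a) ⬝ᵥ V (p (p a)) * (green V a (p (p a)) - green V a (p a)) = 1 := by linarith
      nlinarith
    · intro l hl hla
      simp only [mem_filter, mem_univ, true_and] at hl
      by_cases h0 : V (p a) ⬝ᵥ V l = 0
      · rw [h0, zero_mul]
      · rw [hconst a l ha hla hl, hparent hl h0, sub_self, mul_zero]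
    · intro h
      exact absurd hap (by simpa using h)
  have key : ∀ a b, a < b → b < p a → p a < p b → False := by
    intro a
    induction a using WellFoundedGT.induction with
    | ind a ih =>
      intro b hab hba hpp
      have ha := hne hab
      have hb := hne hba
      have hpa := hne hpp
      have h1 := hconst a b ha hab.ne' hba
      have h2 := green_antitone hV.toIsNormalized hV' hd hab.le hba.le
      have h3 := hdrop a ha hpa
      have h4 : p b < p (p a) := by
        by_contra! hle
        have h5 := green_antitone hV.toIsNormalized hV' hd
          (hab.le.trans (hba.le.trans (hp (p a) hpa).1.1.le)) hle
        linarith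
      exact ih b hab (p a) hba hpp h4
  intro a b c d hab hbc hcd hac hbd
  have h1 := (hp a (hne hab)).2 c (hab.trans hbc) hac
  have h2 := (hp b (hne hbc)).2 d (hbc.trans hcd) hbd
  subst h1 h2
  exact key a b hab hbc hcd

end Green

/-! ### Noncrossing and basic arc diagrams -/

section Arcs

variable {m p : ℕ} (h : (m + 1) + (p + 1) = n + 1)

lemma DecomposableAt.unique {G : SimpleGraph (Fin (n + 1))} {v w : Fin (n + 1)}
    (hv : DecomposableAt G v) (hw : DecomposableAt G w) : v = w := by
  have key : ∀ {v w : Fin (n + 1)}, DecomposableAt G v → DecomposableAt G w → ¬ v < w := by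
    intro v w hv hw hlt
    have h1 := hw.2.2 v (Fin.last n) hlt hv.1 ((hv.2.1 _ hv.1).mpr rfl)
    exact absurd hw.1 (not_lt.mpr h1)
  exact le_antisymm (not_lt.mp (key hw hv)) (not_lt.mp (key hv hw))

lemma decomposableAt_glue (G₁ : SimpleGraph (Fin (m + 1))) (G₂ : SimpleGraph (Fin (p + 1))) :
    DecomposableAt (glue h G₁ G₂) (leftNode h (Fin.last m)) := by
  rw [decomposableAt_iff, comap_leftNode_glue, comap_rightNode_glue]

/-- A graph is a gluing at no more than one place. -/
lemma eq_of_glue_eq {m' p' : ℕ} (h' : (m' + 1) + (p' + 1) = n + 1)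
    {G₁ : SimpleGraph (Fin (m + 1))} {G₂ : SimpleGraph (Fin (p + 1))}
    {G₁' : SimpleGraph (Fin (m' + 1))} {G₂' : SimpleGraph (Fin (p' + 1))}
    (hG : glue h G₁ G₂ = glue h' G₁' G₂') : m = m' := by
  have h1 := decomposableAt_glue h G₁ G₂
  rw [hG] at h1
  simpa using congrArg Fin.val (DecomposableAt.unique h1 (decomposableAt_glue h' G₁' G₂'))

lemma glue_injective {G₁ G₁' : SimpleGraph (Fin (m + 1))} {G₂ G₂' : SimpleGraph (Fin (p + 1))}
    (hG : glue h G₁ G₂ = glue h G₁' G₂') : G₁ = G₁' ∧ G₂ = G₂' :=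
  ⟨by rw [← comap_leftNode_glue h G₁ G₂, hG, comap_leftNode_glue],
    by rw [← comap_rightNode_glue h G₁ G₂, hG, comap_rightNode_glue]⟩

lemma isArcDiagram_glue_iff {G₁ : SimpleGraph (Fin (m + 1))} {G₂ : SimpleGraph (Fin (p + 1))} :
    IsArcDiagram (glue h G₁ G₂) ↔ IsArcDiagram G₁ ∧ IsArcDiagram G₂ := by
  constructor
  · intro hG
    refine ⟨fun i hi => ?_, fun j hj => ?_⟩
    · obtain ⟨k, ⟨h1, h2⟩, h3⟩ := hG (leftNode h i) (leftNode_ne_last h i)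
      rcases node_cases h k with ⟨k, rfl⟩ | ⟨k, rfl⟩
      · refine ⟨k, ⟨(leftNode_lt_leftNode h).mp h1, (glue_adj_left_left h _ _).mp h2⟩, ?_⟩
        rintro l ⟨hl1, hl2⟩
        exact leftNode_injective h (h3 _ ⟨(leftNode_lt_leftNode h).mpr hl1,
          (glue_adj_left_left h _ _).mpr hl2⟩)
      · exact absurd ((glue_adj_left_right h _ _).mp h2).1 hi
    · obtain ⟨k, ⟨h1, h2⟩, h3⟩ := hG (rightNode h j) (fun e => hj ((rightNode_eq_last h).mp e))
      rcases node_cases h k with ⟨k, rfl⟩ | ⟨k, rfl⟩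
      · exact absurd h1 (leftNode_lt_rightNode h _ _).asymm
      · refine ⟨k, ⟨(rightNode_lt_rightNode h).mp h1, (glue_adj_right_right h _ _).mp h2⟩, ?_⟩
        rintro l ⟨hl1, hl2⟩
        exact rightNode_injective h (h3 _ ⟨(rightNode_lt_rightNode h).mpr hl1,
          (glue_adj_right_right h _ _).mpr hl2⟩)
  · rintro ⟨hG₁, hG₂⟩ a ha
    rcases node_cases h a with ⟨i, rfl⟩ | ⟨j, rfl⟩
    · by_cases hi : i = Fin.last m
      · subst hi
        refine ⟨rightNode h (Fin.last p), ⟨leftNode_lt_rightNode h _ _,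
          (glue_adj_left_right h _ _).mpr ⟨rfl, rfl⟩⟩, ?_⟩
        rintro l ⟨hl1, hl2⟩
        rcases node_cases h l with ⟨l, rfl⟩ | ⟨l, rfl⟩
        · exact absurd ((leftNode_lt_leftNode h).mp hl1) (not_lt.mpr (Fin.le_last l))
        · rw [((glue_adj_left_right h _ _).mp hl2).2]
      · obtain ⟨k, ⟨h1, h2⟩, h3⟩ := hG₁ i hi
        refine ⟨leftNode h k, ⟨(leftNode_lt_leftNode h).mpr h1,
          (glue_adj_left_left h _ _).mpr h2⟩, ?_⟩
        rintro l ⟨hl1, hl2⟩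
        rcases node_cases h l with ⟨l, rfl⟩ | ⟨l, rfl⟩
        · rw [h3 l ⟨(leftNode_lt_leftNode h).mp hl1, (glue_adj_left_left h _ _).mp hl2⟩]
        · exact absurd ((glue_adj_left_right h _ _).mp hl2).1 hi
    · obtain ⟨k, ⟨h1, h2⟩, h3⟩ := hG₂ j (fun e => ha ((rightNode_eq_last h).mpr e))
      refine ⟨rightNode h k, ⟨(rightNode_lt_rightNode h).mpr h1,
        (glue_adj_right_right h _ _).mpr h2⟩, ?_⟩
      rintro l ⟨hl1, hl2⟩
      rcases node_cases h l with ⟨l, rfl⟩ | ⟨l, rfl⟩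
      · exact absurd hl1 (leftNode_lt_rightNode h _ _).asymm
      · rw [h3 l ⟨(rightNode_lt_rightNode h).mp hl1, (glue_adj_right_right h _ _).mp hl2⟩]

lemma IsNoncrossing.of_glue {G₁ : SimpleGraph (Fin (m + 1))} {G₂ : SimpleGraph (Fin (p + 1))}
    (hG : IsNoncrossing (glue h G₁ G₂)) : IsNoncrossing G₁ ∧ IsNoncrossing G₂ :=
  ⟨fun a b c d h1 h2 h3 h4 h5 => hG (leftNode h a) (leftNode h b) (leftNode h c) (leftNode h d)
      ((leftNode_lt_leftNode h).mpr h1) ((leftNode_lt_leftNode h).mpr h2)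
      ((leftNode_lt_leftNode h).mpr h3) ((glue_adj_left_left h _ _).mpr h4)
      ((glue_adj_left_left h _ _).mpr h5),
    fun a b c d h1 h2 h3 h4 h5 => hG (rightNode h a) (rightNode h b) (rightNode h c)
      (rightNode h d) ((rightNode_lt_rightNode h).mpr h1) ((rightNode_lt_rightNode h).mpr h2)
      ((rightNode_lt_rightNode h).mpr h3) ((glue_adj_right_right h _ _).mpr h4)
      ((glue_adj_right_right h _ _).mpr h5)⟩

/-- A noncrossing arc diagram decomposes at the smallest neighbour of its last node. -/
lemma exists_eq_glue (hn : n ≠ 0) {G : SimpleGraph (Fin (n + 1))} (hG : IsArcDiagram G)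
    (hc : IsNoncrossing G) : ∃ (m p : ℕ) (h : (m + 1) + (p + 1) = n + 1)
      (G₁ : SimpleGraph (Fin (m + 1))) (G₂ : SimpleGraph (Fin (p + 1))), G = glue h G₁ G₂ := by
  have hex : ∃ j, j ≠ Fin.last n ∧ G.Adj j (Fin.last n) := by
    have hj : (⟨n - 1, by omega⟩ : Fin (n + 1)) ≠ Fin.last n := by
      rw [ne_eq, Fin.ext_iff, Fin.val_last]
      exact fun h => by simp at h; omega
    obtain ⟨k, ⟨h1, h2⟩, -⟩ := hG _ hj
    have : k = Fin.last n := by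
      rw [Fin.lt_def] at h1
      exact Fin.ext (by rw [Fin.val_last]; simp at h1; omega)
    exact ⟨_, hj, this ▸ h2⟩
  obtain ⟨v, ⟨hv1, hv2⟩, hmin⟩ := WellFounded.has_min wellFounded_lt
    {j : Fin (n + 1) | j ≠ Fin.last n ∧ G.Adj j (Fin.last n)} hex
  have hlt : v < Fin.last n := lt_of_le_of_ne (Fin.le_last v) hv1
  have hdec : DecomposableAt G v := by
    refine ⟨hlt, fun k hk => ⟨fun hadj => ?_, fun e => e ▸ hv2⟩, fun j k hjv hjk hadj => ?_⟩
    · exact (hG v hv1).unique ⟨hk, hadj⟩ ⟨hlt, hv2⟩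
    · by_contra! hvk
      rcases eq_or_lt_of_le (Fin.le_last k) with rfl | hkl
      · exact hmin j ⟨(hjv.trans hlt).ne, hadj⟩ hjv
      · exact hc j v k (Fin.last n) hjv hvk hkl hadj hv2
  have hvn : (v : ℕ) < n := hlt
  have h : ((v : ℕ) + 1) + ((n - 1 - v) + 1) = n + 1 := by omega
  refine ⟨v, n - 1 - v, h, _, _, (decomposableAt_iff h).mp ?_⟩
  convert hdec
  exact Fin.ext (by simp)

/-- Noncrossing arc diagrams are basic. -/
theorem isBasic_of_isNoncrossing {G : SimpleGraph (Fin (n + 1))} (hG : IsArcDiagram G)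
    (hc : IsNoncrossing G) : IsBasic G := by
  induction n using Nat.strong_induction_on with
  | _ n ih =>
    by_cases hn : n = 0
    · subst hn
      exact IsBasic.single G
    · obtain ⟨m, p, h, G₁, G₂, rfl⟩ := exists_eq_glue hn hG hc
      obtain ⟨a₁, a₂⟩ := (isArcDiagram_glue_iff h).mp hG
      obtain ⟨c₁, c₂⟩ := hc.of_glue h
      exact IsBasic.glue h G₁ G₂ (ih m (by omega) a₁ c₁) (ih p (by omega) a₂ c₂)

lemma IsBasic.isArcDiagram {G : SimpleGraph (Fin (n + 1))} (hG : IsBasic G) : IsArcDiagram G := by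
  induction hG with
  | single G => exact fun j hj => absurd (Subsingleton.elim (α := Fin 1) j _) hj
  | glue h G₁ G₂ _ _ ih₁ ih₂ => exact (isArcDiagram_glue_iff h).mpr ⟨ih₁, ih₂⟩

/-- Every basic diagram is the diagram of an optimal factor whose dual is optimal, and the dual has an
arc diagram, too. -/
lemma IsBasic.exists_factor {G : SimpleGraph (Fin (n + 1))} (hG : IsBasic G) :
    ∃ V V', IsOptimalFactor V ∧ IsOptimalFactor V' ∧ IsDualFactor V V' ∧
      factorGraph V = G ∧ IsArcDiagram (factorGraph V') := by
  induction hG with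
  | single G =>
    have h1 : IsOptimalFactor (n := 0) 1 := by
      constructor
      · constructor <;> simp [Fin.fin_one_eq_zero]
      · exact fun j k hjk => absurd (Subsingleton.elim (α := Fin 1) j k) hjk
    refine ⟨1, 1, h1, h1, ?_, ?_, fun j hj => absurd (Subsingleton.elim (α := Fin 1) j _) hj⟩
    · ext i j
      simp [hDual_apply, difference, Fin.fin_one_eq_zero]
    · ext i j
      obtain rfl : i = j := Subsingleton.elim (α := Fin 1) i j
      simp
  | @glue m p n h G₁ G₂ _ _ ih₁ ih₂ =>
    obtain ⟨V₁, V₁', a₁, b₁, c₁, rfl, d₁⟩ := ih₁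
    obtain ⟨V₂, V₂', a₂, b₂, c₂, rfl, d₂⟩ := ih₂
    have h' : (p + 1) + (m + 1) = n + 1 := by omega
    refine ⟨glueFactor h V₁ V₂, glueFactor h' V₂' V₁', isOptimalFactor_glueFactor h a₁ a₂,
      isOptimalFactor_glueFactor h' b₂ b₁,
      isDualFactor_glueFactor h h' a₁.toIsNormalized b₂.toIsNormalized c₁ c₂,
      factorGraph_glueFactor h a₂.toIsNormalized, ?_⟩
    rw [factorGraph_glueFactor h' b₁.toIsNormalized]
    exact (isArcDiagram_glue_iff h').mpr ⟨d₂, d₁⟩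

lemma exists_isBasic (n : ℕ) : ∃ G : SimpleGraph (Fin (n + 1)), IsBasic G := by
  induction n with
  | zero => exact ⟨⊥, IsBasic.single _⟩
  | succ n ih =>
    obtain ⟨G, hG⟩ := ih
    exact ⟨_, IsBasic.glue (m := n) (p := 0) rfl G ⊥ hG (IsBasic.single _)⟩

/-- Basic arc diagrams are counted by the Catalan numbers. -/
theorem card_isBasic (n : ℕ) :
    Nat.card {G : SimpleGraph (Fin (n + 1)) // IsBasic G} = catalan n := by
  induction n using Nat.strong_induction_on with
  | _ n ih =>
    cases n with
    | zero =>
      rw [catalan_zero, Nat.card_eq_one_iff_unique]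
      refine ⟨⟨fun G G' => Subtype.ext ?_⟩, ⟨⟨⊥, IsBasic.single _⟩⟩⟩
      ext i j
      obtain rfl : i = j := Subsingleton.elim (α := Fin 1) i j
      simp
    | succ n =>
      have hsize : ∀ x : Finset.HasAntidiagonal.antidiagonal n,
          (x.1.1 + 1) + (x.1.2 + 1) = n + 1 + 1 := by
        intro x
        have := Finset.HasAntidiagonal.mem_antidiagonal.mp x.2
        omega
      set f : (Σ x : Finset.HasAntidiagonal.antidiagonal n,
          {G : SimpleGraph (Fin (x.1.1 + 1)) // IsBasic G} ×
          {G : SimpleGraph (Fin (x.1.2 + 1)) // IsBasic G}) →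
          {G : SimpleGraph (Fin (n + 1 + 1)) // IsBasic G} :=
        fun y => ⟨glue (hsize y.1) y.2.1.1 y.2.2.1,
          IsBasic.glue _ _ _ y.2.1.2 y.2.2.2⟩ with hf
      have hbij : Function.Bijective f := by
        constructor
        · rintro ⟨⟨⟨i, j⟩, hij⟩, ⟨G₁, hG₁⟩, ⟨G₂, hG₂⟩⟩ ⟨⟨⟨i', j'⟩, hij'⟩, ⟨G₁', hG₁'⟩, ⟨G₂', hG₂'⟩⟩ hy
          have hg := congrArg Subtype.val hy
          simp only [hf] at hg
          have hi : i = i' := eq_of_glue_eq _ _ hg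
          have h1 := Finset.HasAntidiagonal.mem_antidiagonal.mp hij
          have h2 := Finset.HasAntidiagonal.mem_antidiagonal.mp hij'
          have hj : j = j' := by simp only at h1 h2; omega
          subst hi hj
          obtain ⟨rfl, rfl⟩ := glue_injective _ hg
          rfl
        · rintro ⟨G, hG⟩
          cases hG with
          | @glue m p _ h G₁ G₂ h₁ h₂ =>
            exact ⟨⟨⟨(m, p), Finset.HasAntidiagonal.mem_antidiagonal.mpr (by simp only; omega)⟩,
              ⟨G₁, h₁⟩,
              ⟨G₂, h₂⟩⟩, rfl⟩
      rw [← Nat.card_congr (Equiv.ofBijective f hbij), Nat.card_sigma, catalan_succ',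
        ← Finset.sum_coe_sort _ fun ij : ℕ × ℕ => catalan ij.1 * catalan ij.2]
      refine Finset.sum_congr rfl fun x _ => ?_
      have := Finset.HasAntidiagonal.mem_antidiagonal.mp x.2
      rw [Nat.card_prod, ih _ (by omega), ih _ (by omega)]

end Arcs

/-! ### Vertices are the optimal matrices whose diagram is an arc diagram -/

lemma diagram_adj_iff {H : Matrix (Fin n) (Fin n) ℝ} (hH : IsLower H) {j : Fin n} {k : Fin (n + 1)}
    (hjk : j.castSucc < k) : (diagram H).Adj j.castSucc k ↔ hCert H k j ≠ 0 := by
  rw [diagram_eq hH, factorGraph_adj, hCert_ne_zero_iff hH, and_iff_right hjk.ne]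

/-- The pairs of nodes with a nonzero certificate, that is, the edges of the diagram. -/
def certSupport (H : Matrix (Fin n) (Fin n) ℝ) : Set (Fin (n + 1) × Fin n) :=
  {q | q.2.castSucc < q.1 ∧ hCert H q.1 q.2 ≠ 0}

lemma numZeroCerts_add_ncard_certSupport (H : Matrix (Fin n) (Fin n) ℝ) :
    numZeroCerts H + (certSupport H).ncard
      = {q : Fin (n + 1) × Fin n | q.2.castSucc < q.1}.ncard := by
  rw [numZeroCerts, certSupport, ← Set.ncard_union_eq]
  · congr 1
    ext q
    simp only [Set.mem_union, Set.mem_ofPred_eq, ← and_or_left, em, ne_eq, and_true]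
  · rw [Set.disjoint_left]
    exact fun q h1 h2 => h2.2 h1.2

lemma certSupport_snd_surjective {H : Matrix (Fin n) (Fin n) ℝ} (hH : H ∈ HStar n) :
    Function.Surjective fun q : certSupport H => q.1.2 := by
  obtain ⟨hL, hV⟩ := mem_HStar_iff.mp hH
  intro j
  obtain ⟨k, hk, hadj⟩ := hV.toIsNormalized.exists_lt_adj (Fin.castSucc_lt_last j).ne
  rw [← diagram_eq hL, diagram_adj_iff hL hk] at hadj
  exact ⟨⟨(k, j), hk, hadj⟩, rfl⟩

lemma le_ncard_certSupport {H : Matrix (Fin n) (Fin n) ℝ} (hH : H ∈ HStar n) :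
    n ≤ (certSupport H).ncard := by
  have := Nat.card_le_card_of_surjective _ (certSupport_snd_surjective hH)
  rwa [Nat.card_fin, Nat.card_coe_set_eq] at this

lemma isArcDiagram_iff_ncard_certSupport {H : Matrix (Fin n) (Fin n) ℝ} (hH : H ∈ HStar n) :
    IsArcDiagram (diagram H) ↔ (certSupport H).ncard = n := by
  have hL : IsLower H := (mem_HStar_iff.mp hH).1
  have hs := certSupport_snd_surjective hH
  constructor
  · intro hG
    have hb : Function.Bijective fun q : certSupport H => q.1.2 := by
      refine ⟨?_, hs⟩
      rintro ⟨⟨k, j⟩, h1, h2⟩ ⟨⟨k', j'⟩, h1', h2'⟩ hjj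
      obtain rfl : j = j' := hjj
      have := (hG j.castSucc (Fin.castSucc_lt_last j).ne).unique
        ⟨h1, (diagram_adj_iff hL h1).mpr h2⟩ ⟨h1', (diagram_adj_iff hL h1').mpr h2'⟩
      simp only at this
      subst this
      rfl
    have := Nat.card_eq_of_bijective _ hb
    rwa [Nat.card_fin, Nat.card_coe_set_eq] at this
  · intro hcard j hj
    have hb := hs.bijective_of_nat_card_le
      (by rw [Nat.card_fin, Nat.card_coe_set_eq, hcard])
    obtain ⟨j, rfl⟩ := Fin.exists_castSucc_eq.mpr hj
    obtain ⟨⟨⟨k, j'⟩, h1, h2⟩, rfl⟩ := hs j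
    refine ⟨k, ⟨h1, (diagram_adj_iff hL h1).mpr h2⟩, ?_⟩
    rintro l ⟨hl1, hl2⟩
    have := @hb.1 ⟨(l, j'), hl1, (diagram_adj_iff hL hl1).mp hl2⟩ ⟨(k, j'), h1, h2⟩ rfl
    exact congrArg (fun q => q.1.1) this

/-- Basic diagrams come from vertices with optimal dual. -/
lemma IsBasic.exists_mem_HStar {G : SimpleGraph (Fin (n + 1))} (hG : IsBasic G) :
    ∃ H, H ∈ HStar n ∧ hDual H ∈ HStar n ∧ diagram H = G ∧ IsArcDiagram (diagram (hDual H)) := by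
  obtain ⟨V, V', hV, hV', hd, rfl, hG'⟩ := IsBasic.exists_factor hG
  obtain ⟨H, hL, rfl⟩ := hV.toIsNormalized.exists_factor_eq
  have h := (isDualFactor_factor_hDual hL hV.toIsNormalized).1
  obtain rfl := h.unique hV.toIsNormalized hd
  exact ⟨H, mem_HStar_iff.mpr ⟨hL, hV⟩, mem_HStar_iff.mpr ⟨hL.hDual, hV'⟩, diagram_eq hL,
    (diagram_eq hL.hDual).symm ▸ hG'⟩

/-- Every node but the last has a larger neighbour, and arc diagrams, where it has just one, do occur:
so these are the diagrams with the fewest edges. -/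
theorem isVertex_iff {H : Matrix (Fin n) (Fin n) ℝ} :
    IsVertex H ↔ H ∈ HStar n ∧ IsArcDiagram (diagram H) := by
  refine and_congr_right fun hH => ?_
  rw [isArcDiagram_iff_ncard_certSupport hH]
  have h1 := numZeroCerts_add_ncard_certSupport H
  constructor
  · intro h
    obtain ⟨G, hG⟩ := exists_isBasic n
    obtain ⟨H₀, hH₀, -, rfl, -⟩ := IsBasic.exists_mem_HStar hG
    have h2 := (isArcDiagram_iff_ncard_certSupport hH₀).mp (IsBasic.isArcDiagram hG)
    have h3 := numZeroCerts_add_ncard_certSupport H₀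
    have h4 := h H₀ hH₀
    have h5 := le_ncard_certSupport hH
    omega
  · intro h H' hH'
    have h3 := numZeroCerts_add_ncard_certSupport H'
    have h5 := le_ncard_certSupport hH'
    omega

lemma IsVertex.eq_of_diagram_eq {H H' : Matrix (Fin n) (Fin n) ℝ} (hH : IsVertex H)
    (hH' : IsVertex H') (h : diagram H = diagram H') : H = H' := by
  obtain ⟨h1, hG⟩ := isVertex_iff.mp hH
  obtain ⟨hL, hV⟩ := mem_HStar_iff.mp h1
  obtain ⟨hL', hV'⟩ := mem_HStar_iff.mp hH'.1
  rw [diagram_eq hL] at hG h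
  rw [diagram_eq hL'] at h
  exact eq_of_factor_eq hL hL' hV.toIsNormalized
    (eq_of_factorGraph_eq hV.toIsNormalized hV'.toIsNormalized hG h)

lemma IsDualDiagram.unique {G G₁ G₂ : SimpleGraph (Fin (n + 1))} (h₁ : IsDualDiagram G G₁)
    (h₂ : IsDualDiagram G G₂) : G₁ = G₂ := by
  obtain ⟨H₁, hv₁, -, rfl, rfl⟩ := h₁
  obtain ⟨H₂, hv₂, -, he, rfl⟩ := h₂
  rw [IsVertex.eq_of_diagram_eq hv₂ hv₁ he]

lemma IsVertex.isBasic_diagram {H : Matrix (Fin n) (Fin n) ℝ} (hH : IsVertex H)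
    (hd : hDual H ∈ HStar n) : IsBasic (diagram H) := by
  obtain ⟨h1, hG⟩ := isVertex_iff.mp hH
  obtain ⟨hL, hV⟩ := mem_HStar_iff.mp h1
  refine isBasic_of_isNoncrossing hG ?_
  rw [diagram_eq hL] at hG ⊢
  exact isNoncrossing_of_isDualFactor hV (mem_HStar_iff.mp hd).2
    (isDualFactor_factor_hDual hL hV.toIsNormalized).1 hG

/-- An optimal dual of a vertex is a vertex: the diagram is then basic, and for basic diagrams the dual
gluing is explicit. -/
lemma isVertex_hDual {H : Matrix (Fin n) (Fin n) ℝ} (hH : IsVertex H) (hd : hDual H ∈ HStar n) :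
    IsVertex (hDual H) := by
  obtain ⟨H₀, hH₀, -, hG, hA⟩ := IsBasic.exists_mem_HStar (IsVertex.isBasic_diagram hH hd)
  have hv₀ : IsVertex H₀ := isVertex_iff.mpr ⟨hH₀, hG ▸ (isVertex_iff.mp hH).2⟩
  rw [IsVertex.eq_of_diagram_eq hv₀ hH hG] at hA
  exact isVertex_iff.mpr ⟨hd, hA⟩

/-! ### Self-dual vertices -/

/-- A self-dual vertex has a noncrossing diagram, so its factor is glued from two blocks.  The dual
glues the duals of the blocks in reverse order; as the place of a gluing is unique, the blocks have
equal size and are dual to each other. -/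
theorem exists_eq_glue_of_hDual_eq (hn : n ≠ 0) {H : Matrix (Fin n) (Fin n) ℝ} (hH : IsVertex H)
    (hself : hDual H = H) : ∃ (m : ℕ) (h : (m + 1) + (m + 1) = n + 1)
      (G₀ G₀A : SimpleGraph (Fin (m + 1))),
      IsDualDiagram G₀ G₀A ∧ diagram H = glue h G₀ G₀A := by
  obtain ⟨h1, hG⟩ := isVertex_iff.mp hH
  obtain ⟨hL, hV⟩ := mem_HStar_iff.mp h1
  have hself' := (isDualFactor_factor_hDual hL hV.toIsNormalized).1
  rw [hself] at hself'
  rw [diagram_eq hL] at hG ⊢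
  obtain ⟨m, p, h, G₁, G₂, hglue⟩ := exists_eq_glue hn hG
    (isNoncrossing_of_isDualFactor hV hV hself' hG)
  obtain ⟨V₁, V₂, hV₁, hV₂, hVeq⟩ := exists_eq_glueFactor h hV hglue
  obtain ⟨H₁, hL₁, rfl⟩ := hV₁.toIsNormalized.exists_factor_eq
  obtain ⟨H₂, hL₂, rfl⟩ := hV₂.toIsNormalized.exists_factor_eq
  obtain ⟨hd₁, hN₁⟩ := isDualFactor_factor_hDual hL₁ hV₁.toIsNormalized
  obtain ⟨hd₂, hN₂⟩ := isDualFactor_factor_hDual hL₂ hV₂.toIsNormalized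
  have h' : (p + 1) + (m + 1) = n + 1 := by omega
  have hdual := isDualFactor_glueFactor h h' hV₁.toIsNormalized hN₂ hd₁ hd₂
  rw [← hVeq] at hdual
  have hVeq' := hself'.unique hV.toIsNormalized hdual
  have hgr := factorGraph_glueFactor h (V₁ := factor H₁) hV₂.toIsNormalized
  rw [← hVeq] at hgr
  obtain rfl : m = p := by
    have hgr' := factorGraph_glueFactor h' (V₁ := factor (hDual H₂)) hN₁
    rw [← hVeq'] at hgr'
    exact eq_of_glue_eq h h' (hgr.symm.trans hgr')
  obtain ⟨-, he⟩ := glueFactor_injective h (hVeq.symm.trans hVeq')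
  refine ⟨m, h, diagram H₁, diagram (hDual H₁), ⟨H₁, ?_, ?_, rfl, rfl⟩, ?_⟩
  · refine isVertex_iff.mpr ⟨mem_HStar_iff.mpr ⟨hL₁, hV₁⟩, ?_⟩
    rw [hgr, isArcDiagram_glue_iff] at hG
    rw [diagram_eq hL₁]
    exact hG.1
  · exact mem_HStar_iff.mpr ⟨hL₁.hDual, he ▸ hV₂⟩
  · rw [hgr, he, diagram_eq hL₁, diagram_eq hL₁.hDual]

/-- Gluing an optimal vertex with optimal dual to this dual gives a self-dual vertex. -/
theorem exists_isVertex_hDual_eq {m : ℕ} (h : (m + 1) + (m + 1) = n + 1)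
    {G₀ G₀A : SimpleGraph (Fin (m + 1))} (hG : IsDualDiagram G₀ G₀A) :
    ∃ H : Matrix (Fin n) (Fin n) ℝ,
      IsVertex H ∧ hDual H = H ∧ diagram H = glue h G₀ G₀A := by
  obtain ⟨H₀, hv, hd, rfl, rfl⟩ := hG
  obtain ⟨hL₀, hV₀⟩ := mem_HStar_iff.mp hv.1
  obtain ⟨hL₁, hV₁⟩ := mem_HStar_iff.mp hd
  have hdual := (isDualFactor_factor_hDual hL₀ hV₀.toIsNormalized).1
  have hA : IsArcDiagram (diagram (hDual H₀)) := (isVertex_iff.mp (isVertex_hDual hv hd)).2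
  have hopt := isOptimalFactor_glueFactor h hV₀ hV₁
  obtain ⟨H, hL, hH⟩ := hopt.toIsNormalized.exists_factor_eq
  have hself := isDualFactor_glueFactor h h hV₀.toIsNormalized hV₀.toIsNormalized hdual hdual.symm
  have hG : diagram H = glue h (diagram H₀) (diagram (hDual H₀)) := by
    rw [diagram_eq hL, hH, factorGraph_glueFactor h hV₁.toIsNormalized, diagram_eq hL₀,
      diagram_eq hL₁]
  rw [← hH] at hopt hself
  obtain ⟨hd', hN'⟩ := isDualFactor_factor_hDual hL hopt.toIsNormalized
  refine ⟨H, isVertex_iff.mpr ⟨mem_HStar_iff.mpr ⟨hL, hopt⟩, ?_⟩,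
    eq_of_factor_eq hL.hDual hL hN' (hd'.unique hopt.toIsNormalized hself), hG⟩
  rw [hG]
  exact (isArcDiagram_glue_iff h).mpr ⟨(isVertex_iff.mp hv).2, hA⟩

lemma hDual_eq_of_diagram_eq_glue {m : ℕ} (h : (m + 1) + (m + 1) = n + 1)
    {G₀ G₀A : SimpleGraph (Fin (m + 1))} (hG : IsDualDiagram G₀ G₀A)
    {H : Matrix (Fin n) (Fin n) ℝ} (hH : IsVertex H) (hglue : diagram H = glue h G₀ G₀A) :
    hDual H = H := by
  obtain ⟨H', hH', hself, hG'⟩ := exists_isVertex_hDual_eq h hG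
  rwa [IsVertex.eq_of_diagram_eq hH hH' (hglue.trans hG'.symm)]

lemma IsDualDiagram.isBasic {G G' : SimpleGraph (Fin (n + 1))} (hG : IsDualDiagram G G') :
    IsBasic G := by
  obtain ⟨H, hv, hd, rfl, -⟩ := hG
  exact IsVertex.isBasic_diagram hv hd

lemma IsVertex.exists_isDualDiagram_of_hDual_eq {m : ℕ} (h : (m + 1) + (m + 1) = n + 1)
    {H : Matrix (Fin n) (Fin n) ℝ} (hH : IsVertex H) (hself : hDual H = H) :
    ∃ G₀ G₀A : SimpleGraph (Fin (m + 1)), IsDualDiagram G₀ G₀A ∧ diagram H = glue h G₀ G₀A := by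
  obtain ⟨m', h', G₀, G₀A, hG⟩ := exists_eq_glue_of_hDual_eq (by omega) hH hself
  obtain rfl : m = m' := by omega
  exact ⟨G₀, G₀A, hG⟩

/-- The left half of the diagram identifies self-dual vertices with basic diagrams. -/
theorem ncard_selfDual {m : ℕ} (h : (m + 1) + (m + 1) = n + 1) :
    {H : Matrix (Fin n) (Fin n) ℝ | IsVertex H ∧ hDual H = H}.ncard = catalan m := by
  rw [← card_isBasic m, ← Nat.card_coe_set_eq]
  have hleft : ∀ H : {H : Matrix (Fin n) (Fin n) ℝ | IsVertex H ∧ hDual H = H},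
      IsBasic ((diagram H.1).comap (leftNode h)) := by
    rintro ⟨H, hH, hself⟩
    obtain ⟨G₀, G₀A, hd, hG⟩ := IsVertex.exists_isDualDiagram_of_hDual_eq h hH hself
    rw [hG, comap_leftNode_glue]
    exact IsDualDiagram.isBasic hd
  refine Nat.card_eq_of_bijective (fun H => ⟨_, hleft H⟩) ⟨?_, ?_⟩
  · rintro ⟨H, hH, hself⟩ ⟨H', hH', hself'⟩ he
    obtain ⟨G₀, G₀A, hd, hG⟩ := IsVertex.exists_isDualDiagram_of_hDual_eq h hH hself
    obtain ⟨G₀', G₀A', hd', hG'⟩ := IsVertex.exists_isDualDiagram_of_hDual_eq h hH' hself'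
    have he' := congrArg Subtype.val he
    simp only [hG, hG', comap_leftNode_glue] at he'
    subst he'
    rw [IsDualDiagram.unique hd' hd] at hG'
    exact Subtype.ext (IsVertex.eq_of_diagram_eq hH hH' (hG.trans hG'.symm))
  · rintro ⟨G₀, hG₀⟩
    obtain ⟨H₀, hH₀, hd₀, rfl, -⟩ := IsBasic.exists_mem_HStar hG₀
    obtain ⟨H, hH, hself, hG⟩ := exists_isVertex_hDual_eq h
      ⟨H₀, isVertex_iff.mpr ⟨hH₀, IsBasic.isArcDiagram hG₀⟩, hd₀, rfl, rfl⟩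
    exact ⟨⟨H, hH, hself⟩, Subtype.ext (by simp only [hG, comap_leftNode_glue])⟩

end OptimalVertex
end

theorem mainTheorem5 (n : ℕ) (hn : 2 ≤ n + 1) :
    (∀ H : Matrix (Fin n) (Fin n) ℝ, IsVertex H →
      (hDual H = H ↔
        ∃ (m : ℕ) (h : (m + 1) + (m + 1) = n + 1) (G₀ G₀A : SimpleGraph (Fin (m + 1))),
          IsBasic G₀ ∧ IsDualDiagram G₀ G₀A ∧ diagram H = glue h G₀ G₀A) ∧
      (hDual H = H ↔
        ∃ (m : ℕ) (h : (m + 1) + (m + 1) = n + 1),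
          DecomposableAt (diagram H) (leftNode h (Fin.last m)) ∧
          IsDualDiagram ((diagram H).comap (leftNode h)) ((diagram H).comap (rightNode h)))) ∧
    (Odd (n + 1) → ¬ ∃ H : Matrix (Fin n) (Fin n) ℝ, IsVertex H ∧ hDual H = H) ∧
    (Even (n + 1) →
      {H : Matrix (Fin n) (Fin n) ℝ | IsVertex H ∧ hDual H = H}.ncard
          = catalan ((n + 1) / 2 - 1) ∧
      (catalan ((n + 1) / 2 - 1) : ℚ)
          = 1 / (((n + 1 : ℕ) : ℚ) / 2) * ((n + 1 - 2).choose ((n + 1) / 2 - 1) : ℚ)) := by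
  have hne : n ≠ 0 := by omega
  refine ⟨fun H hH => ⟨⟨fun hself => ?_, ?_⟩, ⟨fun hself => ?_, ?_⟩⟩, ?_, fun heven => ?_⟩
  · obtain ⟨m, h, G₀, G₀A, hd, hG⟩ := OptimalVertex.exists_eq_glue_of_hDual_eq hne hH hself
    exact ⟨m, h, G₀, G₀A, OptimalVertex.IsDualDiagram.isBasic hd, hd, hG⟩
  · rintro ⟨m, h, G₀, G₀A, -, hd, hG⟩
    exact OptimalVertex.hDual_eq_of_diagram_eq_glue h hd hH hG
  · obtain ⟨m, h, G₀, G₀A, hd, hG⟩ := OptimalVertex.exists_eq_glue_of_hDual_eq hne hH hself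
    refine ⟨m, h, ?_⟩
    rw [hG, OptimalVertex.comap_leftNode_glue, OptimalVertex.comap_rightNode_glue]
    exact ⟨OptimalVertex.decomposableAt_glue h G₀ G₀A, hd⟩
  · rintro ⟨m, h, hdec, hd⟩
    exact OptimalVertex.hDual_eq_of_diagram_eq_glue h hd hH
      ((OptimalVertex.decomposableAt_iff h).mp hdec)
  · rintro hodd ⟨H, hH, hself⟩
    obtain ⟨m, h, -⟩ := OptimalVertex.exists_eq_glue_of_hDual_eq hne hH hself
    exact Nat.not_odd_iff_even.mpr ⟨m + 1, h.symm⟩ hodd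
  · obtain ⟨m, h⟩ : ∃ m, (m + 1) + (m + 1) = n + 1 := by
      obtain ⟨r, hr⟩ := heven
      exact ⟨r - 1, by omega⟩
    have hm : (n + 1) / 2 - 1 = m := by omega
    rw [hm, show n + 1 - 2 = 2 * m by omega]
    refine ⟨OptimalVertex.ncard_selfDual h, ?_⟩
    have hcat : ((m : ℚ) + 1) * catalan m = ((2 * m).choose m : ℚ) := by
      exact_mod_cast succ_mul_catalan_eq_centralBinom m
    rw [← hcat, ← h]
    push_cast
    have : (m : ℚ) + 1 ≠ 0 := by positivity
    field_simp
    ring
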